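/- Let $M$ be a smooth manifold without boundary, of any finite dimension, with a smooth Riemannian metric $\langle\cdot,\cdot\rangle$, Levi-Civita connection $\nabla$, and curvature tensor $R(X,Y)Z=\nabla_X\nabla_YZ-\nabla_Y\nabla_XZ-\nabla_{[X,Y]}Z$. Let $J\subset\mathbb R$ be open (for instance $J=(-\tau,\tau)$), let $u(t,\cdot)$, $t\in J$, be a time-dependent vector field on $M$ which is $C^2$ in $(t,x)\in J\times M$, and let $p(t,\cdot)$, $t\in J$, be $C^2$ functions on $M$, such that on $J\times M$ the Euler equations hold: $$\frac{\partial u}{\partial t}+\nabla_u u=-\operatorname{grad}p,\qquad \operatorname{div}u=\operatorname{tr}(\nabla u)=0 .$$ Let $\varepsilon>0$ and let $\varphi(s;t)$, $(s,t)\in(-\varepsilon,\varepsilon)\times J$, be a material line advected by the flow, that is, a $C^2$ map to $M$ with $\partial\varphi/\partial t(s;t)=u(t,\varphi(s;t))$. Put $x(t)=\varphi(0;t)$ and $\xi(t)=\frac{\partial}{\partial s}\big|_{s=0}\varphi(s;t)\in T_{x(t)}M$. Then $t\mapsto|\xi(t)|^2$ is twice differentiable on $J$, and for every $t\in J$ $$\frac12\frac{d^2}{dt^2}|\xi|^2=-\langle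 \mathsf H(p)\xi,\xi\rangle-\langle R(\xi,u)u,\xi\rangle+|\nabla_\xi u|^2,$$ where $\mathsf H(p)v=\nabla_v(\operatorname{grad}p)$ is the Hessian tensor of $p$, and $p$, $u$, $R$ are evaluated at time $t$ and at the point $x(t)$. Equivalently, the linear endomorphism (the strain acceleration tensor) of $T_{x(t)}M$ $$\mathsf M=-\mathsf H(p)-R(\cdot,u)u+{}^{t}(\nabla u)(\nabla u),$$ where $\nabla u$ is the map $v\mapsto\nabla_vu$ and ${}^{t}(\nabla u)$ is its adjoint, satisfies $$\frac12\frac{d^2}{dt^2}|\xi|^2=\langle\mathsf M\xi,\xi\rangle .$$ -/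

import Mathlib

open Bundle FiberBundle Manifold ContDiff Set VectorField

noncomputable section

namespace RiemannianFluid

section LeviCivita

variable {E : Type*} [NormedAddCommGroup E] [NormedSpace ℝ E]
  {H : Type*} [TopologicalSpace H] (I : ModelWithCorners ℝ E H)
  {M : Type*} [TopologicalSpace M] [ChartedSpace H M]
  [RiemannianBundle (fun x : M ↦ TangentSpace I x)]

/-- The function `⟨X, Y⟩` of two vector fields. -/
def metricPairing (X Y : Π x : M, TangentSpace I x) (x : M) : ℝ := inner ℝ (X x) (Y x)

/-- The right-hand side of the Koszul formula, which is equal to `2 ⟨∇_X Y, Z⟩` for the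
Levi-Civita connection `∇`. -/
def koszul (X Y Z : Π x : M, TangentSpace I x) (x : M) : ℝ :=
  mvfderiv I (metricPairing I Y Z) x (X x) + mvfderiv I (metricPairing I Z X) x (Y x)
    - mvfderiv I (metricPairing I X Y) x (Z x)
    + inner ℝ (mlieBracket I X Y x) (Z x) - inner ℝ (mlieBracket I Y Z x) (X x)
    + inner ℝ (mlieBracket I Z X x) (Y x)

variable {I}

theorem metricPairing_add_left (X X' Y : Π x : M, TangentSpace I x) :
    metricPairing I (X + X') Y = metricPairing I X Y + metricPairing I X' Y := by
  ext y; simp [metricPairing, inner_add_left]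

theorem metricPairing_smul_left (f : M → ℝ) (X Y : Π x : M, TangentSpace I x) :
    metricPairing I (f • X) Y = f * metricPairing I X Y := by
  ext y; simp [metricPairing, inner_smul_left]

theorem metricPairing_comm (X Y : Π x : M, TangentSpace I x) :
    metricPairing I X Y = metricPairing I Y X := by
  ext y; simp [metricPairing, real_inner_comm]

variable [IsManifold I ∞ M] [IsContMDiffRiemannianBundle I ∞ E (fun x : M ↦ TangentSpace I x)]

theorem mdifferentiableAt_metricPairing {X Y : Π x : M, TangentSpace I x} {x : M}
    (hX : MDiffAt (T% X) x) (hY : MDiffAt (T% Y) x) :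
    MDifferentiableAt I 𝓘(ℝ, ℝ) (metricPairing I X Y) x :=
  MDifferentiableAt.inner_bundle (F := E) (E := fun x : M ↦ TangentSpace I x) (b := fun x ↦ x)
     hX hY

variable [FiniteDimensional ℝ E]

theorem koszul_tensorial_left (Y Z : Π x : M, TangentSpace I x) {x : M}
    (hY : MDiffAt (T% Y) x) (hZ : MDiffAt (T% Z) x) :
    TensorialAt I E (fun X ↦ koszul I X Y Z x) x where
  smul {f X} hf hX := by
    have := FiniteDimensional.complete ℝ E
    have h1 := mdifferentiableAt_metricPairing hX hY
    have h2 := mdifferentiableAt_metricPairing hX hZ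
    simp only [koszul, metricPairing_comm Z, metricPairing_smul_left, mvfderiv_mul hf h1,
      mvfderiv_mul hf h2, mlieBracket_smul_left hf hX, mlieBracket_smul_right hf hX]
    simp [inner_add_left, inner_smul_left, inner_smul_right, metricPairing,
      real_inner_comm]
    ring
  add {X X'} hX hX' := by
    have := FiniteDimensional.complete ℝ E
    have h1 := mdifferentiableAt_metricPairing hX hY
    have h2 := mdifferentiableAt_metricPairing hX hZ
    have h1' := mdifferentiableAt_metricPairing hX' hY
    have h2' := mdifferentiableAt_metricPairing hX' hZ
    simp only [koszul, metricPairing_comm Z, metricPairing_add_left, mvfderiv_add h1 h1',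
      mvfderiv_add h2 h2', mlieBracket_add_left hX hX', mlieBracket_add_right hX hX']
    simp [inner_add_left, inner_add_right]
    ring

theorem koszul_tensorial_right (X Y : Π x : M, TangentSpace I x) {x : M}
    (hX : MDiffAt (T% X) x) (hY : MDiffAt (T% Y) x) :
    TensorialAt I E (fun Z ↦ koszul I X Y Z x) x where
  smul {f Z} hf hZ := by
    have := FiniteDimensional.complete ℝ E
    have h1 := mdifferentiableAt_metricPairing hZ hX
    have h2 := mdifferentiableAt_metricPairing hZ hY
    simp only [koszul, metricPairing_comm Y, metricPairing_smul_left, mvfderiv_mul hf h1,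
      mvfderiv_mul hf h2, mlieBracket_smul_left hf hZ, mlieBracket_smul_right hf hZ]
    simp [inner_add_left, inner_smul_left, inner_smul_right, metricPairing,
      real_inner_comm]
    ring
  add {Z Z'} hZ hZ' := by
    have := FiniteDimensional.complete ℝ E
    have h1 := mdifferentiableAt_metricPairing hZ hX
    have h2 := mdifferentiableAt_metricPairing hZ hY
    have h1' := mdifferentiableAt_metricPairing hZ' hX
    have h2' := mdifferentiableAt_metricPairing hZ' hY
    simp only [koszul, metricPairing_comm Y, metricPairing_add_left, mvfderiv_add h1 h1',
      mvfderiv_add h2 h2', mlieBracket_add_left hZ hZ', mlieBracket_add_right hZ hZ']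
    simp [inner_add_left, inner_add_right]
    ring

theorem koszul_add_middle {X Y Y' Z : Π x : M, TangentSpace I x} {x : M}
    (hX : MDiffAt (T% X) x) (hY : MDiffAt (T% Y) x) (hY' : MDiffAt (T% Y') x)
    (hZ : MDiffAt (T% Z) x) :
    koszul I X (Y + Y') Z x = koszul I X Y Z x + koszul I X Y' Z x := by
  have := FiniteDimensional.complete ℝ E
  have h1 := mdifferentiableAt_metricPairing hY hX
  have h2 := mdifferentiableAt_metricPairing hY hZ
  have h1' := mdifferentiableAt_metricPairing hY' hX
  have h2' := mdifferentiableAt_metricPairing hY' hZ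
  simp only [koszul, metricPairing_comm X, metricPairing_add_left, mvfderiv_add h1 h1',
    mvfderiv_add h2 h2', mlieBracket_add_left hY hY', mlieBracket_add_right hY hY']
  simp [inner_add_left, inner_add_right]
  ring

theorem koszul_smul_middle {X Y Z : Π x : M, TangentSpace I x} {f : M → ℝ} {x : M}
    (hf : MDiffAt f x) (hX : MDiffAt (T% X) x) (hY : MDiffAt (T% Y) x)
    (hZ : MDiffAt (T% Z) x) :
    koszul I X (f • Y) Z x
      = f x * koszul I X Y Z x + 2 * (mvfderiv I f x (X x) * inner ℝ (Y x) (Z x)) := by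
  have := FiniteDimensional.complete ℝ E
  have h1 := mdifferentiableAt_metricPairing hY hX
  have h2 := mdifferentiableAt_metricPairing hY hZ
  simp only [koszul, metricPairing_comm X, metricPairing_smul_left, mvfderiv_mul hf h1,
    mvfderiv_mul hf h2, mlieBracket_smul_left hf hY, mlieBracket_smul_right hf hY]
  simp [inner_add_left, inner_smul_left, inner_smul_right, metricPairing,
      real_inner_comm]
  ring

/-- The bilinear form `(v, w) ↦ 2 ⟨∇_v Y, w⟩` on `T_x M`, for a vector field `Y` which is
differentiable at `x`: its value is `koszul X Y Z x` for any `X`, `Z` with `X x = v`, `Z x = w`. -/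
def koszulForm (Y : Π x : M, TangentSpace I x) (x : M) (hY : MDiffAt (T% Y) x) :
    TangentSpace I x →L[ℝ] TangentSpace I x →L[ℝ] ℝ :=
  TensorialAt.mkHom₂ (F := E) (F' := E) (fun X Z ↦ koszul I X Y Z x) x
    (fun Z hZ ↦ koszul_tensorial_left Y Z hY hZ) (fun X hX ↦ koszul_tensorial_right X Y hX hY)

theorem koszulForm_apply {X Y Z : Π x : M, TangentSpace I x} {x : M} (hX : MDiffAt (T% X) x)
    (hY : MDiffAt (T% Y) x) (hZ : MDiffAt (T% Z) x) :
    koszulForm Y x hY (X x) (Z x) = koszul I X Y Z x :=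
  TensorialAt.mkHom₂_apply _ _ hX hZ

instance (x : M) : FiniteDimensional ℝ (TangentSpace I x) :=
  inferInstanceAs (FiniteDimensional ℝ E)

instance (x : M) : CompleteSpace (TangentSpace I x) := FiniteDimensional.complete ℝ _

/-- The vector of `T_x M` which represents a linear form through the metric. -/
def sharp (x : M) : (TangentSpace I x →L[ℝ] ℝ) →ₗ[ℝ] TangentSpace I x where
  toFun l := (InnerProductSpace.toDual ℝ (TangentSpace I x)).symm l
  map_add' l l' := by simp
  map_smul' c l := by simp

theorem inner_sharp (x : M) (l : TangentSpace I x →L[ℝ] ℝ) (w : TangentSpace I x) :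
    inner ℝ (sharp x l) w = l w := by
  simp [sharp]

open Classical in
/-- `v ↦ ∇_v Y` on `T_x M`, with the value `0` if `Y` is not differentiable at `x`. -/
def leviCivitaFun (Y : Π x : M, TangentSpace I x) (x : M) :
    TangentSpace I x →L[ℝ] TangentSpace I x :=
  if hY : MDiffAt (T% Y) x then
    LinearMap.toContinuousLinearMap
      ((1 / 2 : ℝ) • (sharp x).comp
        (koszulForm Y x hY : TangentSpace I x →ₗ[ℝ] (TangentSpace I x →L[ℝ] ℝ)))
  else 0

theorem inner_leviCivitaFun {X Y Z : Π x : M, TangentSpace I x} {x : M}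
    (hX : MDiffAt (T% X) x) (hY : MDiffAt (T% Y) x) (hZ : MDiffAt (T% Z) x) :
    inner ℝ (leviCivitaFun Y x (X x)) (Z x) = (1 / 2) * koszul I X Y Z x := by
  rw [← koszulForm_apply hX hY hZ, ← inner_sharp, leviCivitaFun, dif_pos hY]
  simp [inner_smul_left]

variable (I M) in
/-- The Levi-Civita connection `∇`, built from the Koszul formula. The vector `∇_X Y` at `x` is
written `leviCivita I M Y x (X x)`. -/
def leviCivita : CovariantDerivative I E (fun x : M ↦ TangentSpace I x) where
  toFun := leviCivitaFun
  isCovariantDerivativeOnUniv :=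
    { add := by
        intro Y Y' x hY hY' _
        ext v
        refine ext_inner_right ℝ fun w ↦ ?_
        have h := mdifferentiableAt_extend I E (V := fun x : M ↦ TangentSpace I x) v
        have h' := mdifferentiableAt_extend I E (V := fun x : M ↦ TangentSpace I x) w
        have e1 := inner_leviCivitaFun h hY h'
        have e2 := inner_leviCivitaFun h hY' h'
        have e3 := inner_leviCivitaFun h (mdifferentiableAt_add_section hY hY') h'
        rw [koszul_add_middle h hY hY' h'] at e3
        simp only [extend_apply_self] at e1 e2 e3
        simp only [add_apply, inner_add_left, e1, e2, e3]
        ring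
      leibniz := by
        intro Y f x hY hf _
        ext v
        refine ext_inner_right ℝ fun w ↦ ?_
        have h := mdifferentiableAt_extend I E (V := fun x : M ↦ TangentSpace I x) v
        have h' := mdifferentiableAt_extend I E (V := fun x : M ↦ TangentSpace I x) w
        have e1 := inner_leviCivitaFun h hY h'
        have e3 := inner_leviCivitaFun h (hf.smul_section hY) h'
        rw [koszul_smul_middle hf h hY h'] at e3
        simp only [extend_apply_self] at e1 e3
        simp only [add_apply, inner_add_left, e3,
          smul_apply, inner_smul_left, ContinuousLinearMap.smulRight_apply, e1]
        simp
        ring }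

theorem inner_leviCivita {X Y Z : Π x : M, TangentSpace I x} {x : M}
    (hX : MDiffAt (T% X) x) (hY : MDiffAt (T% Y) x) (hZ : MDiffAt (T% Z) x) :
    2 * inner ℝ (leviCivita I M Y x (X x)) (Z x) = koszul I X Y Z x := by
  have := inner_leviCivitaFun hX hY hZ
  change 2 * inner ℝ (leviCivitaFun Y x (X x)) (Z x) = _
  linarith

/-- The Levi-Civita connection has no torsion. -/
theorem leviCivita_torsionFree {X Y : Π x : M, TangentSpace I x} {x : M}
    (hX : MDiffAt (T% X) x) (hY : MDiffAt (T% Y) x) :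
    leviCivita I M Y x (X x) - leviCivita I M X x (Y x) = mlieBracket I X Y x := by
  refine ext_inner_right ℝ fun w ↦ ?_
  have h' := mdifferentiableAt_extend I E (V := fun x : M ↦ TangentSpace I x) w
  have e1 := inner_leviCivita hX hY h'
  have e2 := inner_leviCivita hY hX h'
  have b1 := mlieBracket_swap_apply (I := I) (V := Y) (W := X) (x := x)
  have b2 := mlieBracket_swap_apply (I := I) (V := extend E w) (W := X) (x := x)
  have b3 := mlieBracket_swap_apply (I := I) (V := extend E w) (W := Y) (x := x)
  simp only [koszul, b1, b2, b3, inner_neg_left, extend_apply_self, metricPairing_comm (extend E w),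
    metricPairing_comm Y X] at e1 e2
  rw [inner_sub_left]
  linarith

/-- The Levi-Civita connection is compatible with the metric. -/
theorem leviCivita_metric {X Y Z : Π x : M, TangentSpace I x} {x : M}
    (hX : MDiffAt (T% X) x) (hY : MDiffAt (T% Y) x) (hZ : MDiffAt (T% Z) x) :
    mvfderiv I (metricPairing I Y Z) x (X x)
      = inner ℝ (leviCivita I M Y x (X x)) (Z x) + inner ℝ (Y x) (leviCivita I M Z x (X x)) := by
  have e1 := inner_leviCivita hX hY hZ
  have e2 := inner_leviCivita hX hZ hY
  have b1 := mlieBracket_swap_apply (I := I) (V := Y) (W := X) (x := x)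
  have b2 := mlieBracket_swap_apply (I := I) (V := Z) (W := X) (x := x)
  have b3 := mlieBracket_swap_apply (I := I) (V := Z) (W := Y) (x := x)
  simp only [koszul, b1, b2, b3, inner_neg_left, metricPairing_comm Z,
    metricPairing_comm Y X] at e1 e2
  rw [real_inner_comm _ (Y x)]
  linarith

end LeviCivita

section Fluid

variable {E : Type*} [NormedAddCommGroup E] [NormedSpace ℝ E]
  {H : Type*} [TopologicalSpace H] (I : ModelWithCorners ℝ E H)
  {M : Type*} [TopologicalSpace M] [ChartedSpace H M]

/-- A material line advected by the time-dependent vector field `u` during the set of times `J`: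
a map `φ` of class `C²` in `(s, t) ∈ (-ε, ε) × J`, such that every `t ↦ φ s t` is a particle
trajectory, that is, `∂φ/∂t (s, t) = u (t, φ s t)`. -/
structure IsMaterialLine [IsManifold I ∞ M] (J : Set ℝ) (u : ℝ → Π x : M, TangentSpace I x)
    (ε : ℝ) (φ : ℝ → ℝ → M) : Prop where
  contMDiffOn : ContMDiffOn 𝓘(ℝ, ℝ × ℝ) I 2 (fun q : ℝ × ℝ ↦ φ q.1 q.2) (Ioo (-ε) ε ×ˢ J)
  hasMFDerivAt : ∀ s ∈ Ioo (-ε) ε, ∀ t ∈ J,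
    HasMFDerivAt 𝓘(ℝ, ℝ) I (φ s) t ((1 : ℝ →L[ℝ] ℝ).smulRight (u t (φ s t)))

/-- The tangent vector `ξ(t) = d/ds φ(s; t)` at `s = 0`. -/
def materialTangent (φ : ℝ → ℝ → M) (t : ℝ) : TangentSpace I (φ 0 t) :=
  mfderiv 𝓘(ℝ, ℝ) I (fun s ↦ φ s t) 0 (1 : ℝ)

variable [FiniteDimensional ℝ E] [IsManifold I ∞ M]
  [RiemannianBundle (fun x : M ↦ TangentSpace I x)]
  [IsContMDiffRiemannianBundle I ∞ E (fun x : M ↦ TangentSpace I x)]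

/-- The gradient of a function, as a vector field. -/
def grad (f : M → ℝ) (x : M) : TangentSpace I x := sharp x (mvfderiv I f x)

/-- The Hessian tensor `v ↦ ∇_v (grad f)` at `x`. -/
def hessian (f : M → ℝ) (x : M) : TangentSpace I x →L[ℝ] TangentSpace I x :=
  leviCivita I M (grad I f) x

/-- The divergence of a vector field: the trace of `v ↦ ∇_v X`. -/
def divergence (X : Π x : M, TangentSpace I x) (x : M) : ℝ :=
  LinearMap.trace ℝ (TangentSpace I x) (leviCivita I M X x).toLinearMap

/-- `∇_X ∇_Y Z - ∇_Y ∇_X Z - ∇_[X, Y] Z` at `x`. -/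
def curvatureField (X Y Z : Π x : M, TangentSpace I x) (x : M) : TangentSpace I x :=
  leviCivita I M (fun y ↦ leviCivita I M Z y (Y y)) x (X x)
    - leviCivita I M (fun y ↦ leviCivita I M Z y (X y)) x (Y x)
    - leviCivita I M Z x (mlieBracket I X Y x)

/-- The curvature tensor `R(v, w) z` of tangent vectors at `x`: the value at `x` of
`∇_X ∇_Y Z - ∇_Y ∇_X Z - ∇_[X, Y] Z` for vector fields `X`, `Y`, `Z` which are smooth near `x`
and take the values `v`, `w`, `z` at `x`. -/
def curvature {x : M} (v w z : TangentSpace I x) : TangentSpace I x :=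
  curvatureField I (extend E v) (extend E w) (extend E z) x

/-- The strain acceleration tensor `-H(p) - R(·, u) u + ᵗ(∇u) (∇u)` at `x`. -/
def strainAcceleration (u : Π x : M, TangentSpace I x) (p : M → ℝ) (x : M)
    (v : TangentSpace I x) : TangentSpace I x :=
  -hessian I p x v - curvature I v (u x) (u x)
    + ContinuousLinearMap.adjoint (leviCivita I M u x) (leviCivita I M u x v)

/-- `u`, `p` is an Euler flow (of class `C²`) during the set of times `J`. -/
structure IsEulerFlow (J : Set ℝ) (u : ℝ → Π x : M, TangentSpace I x) (p : ℝ → M → ℝ) : Prop where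
  contMDiffOn_velocity : ContMDiffOn (𝓘(ℝ, ℝ).prod I) I.tangent 2
    (fun q : ℝ × M ↦ (⟨q.2, u q.1 q.2⟩ : TangentBundle I M)) (J ×ˢ univ)
  contMDiff_pressure : ∀ t ∈ J, ContMDiff I 𝓘(ℝ, ℝ) 2 (p t)
  momentum : ∀ t ∈ J, ∀ x : M,
    deriv (fun τ ↦ u τ x) t + leviCivita I M (u t) x (u t x) = -grad I (p t) x
  incompressible : ∀ t ∈ J, ∀ x : M, divergence I (u t) x = 0

end Fluid

end RiemannianFluid

end

/-!
The identity is proved in one chart, the preferred one at the point `x(t)` at which it is asserted.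
Write `g` for the metric in this chart, `Γ` for its Christoffel symbols, `U` for the velocity and
`P` for the pressure gradient. By the Koszul formula the Levi-Civita connection is
`∇_v Y = DY(v) + Γ(v, Y)` (`toModel_leviCivita`), and the curvature is the usual expression in `Γ`
and `DΓ` (`toModel_curvature`).

Since the mixed derivatives of the material line commute, its tangent satisfies `ξ' = DU(ξ)`
(`hasDerivAt_fderiv_flow`); with the symmetry of `Γ`, this says that the covariant derivative of `ξ`
along the trajectory is `S = ∇_ξ u = DU(ξ) + Γ(ξ, U)`. As the connection preserves the metric
(`hasDerivAt_metric_curve`), `d/dt |ξ|² = 2 ⟨S, ξ⟩` for all times near `t`, and the covariant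
derivative of `S` is needed only at time `t`. It contains the derivatives of `U` of order two; these
are eliminated by differentiating the momentum equation `∂U/∂t + DU(U) + Γ(U, U) = -P` in the
direction `ξ` (`fderiv_momentum`), and what is left is `-∇_ξ P - R(ξ, u) u`
(`hasDerivAt_velocityGradient_euler`). Hence `½ d²/dt² |ξ|² = ⟨-∇_ξ P - R(ξ, u) u, ξ⟩ + |S|²`.

The momentum equation also shows that `P` is differentiable, so the Hessian of the pressure is not
a junk value of the connection. The strain acceleration tensor is linear because the curvature is
linear in its first argument, which is visible on its coordinate expression.
-/

open Bundle FiberBundle Manifold ContDiff Set VectorField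
open scoped Topology

noncomputable section

namespace RiemannianFluid

/-! ### The tangent bundle read in a chart -/

section TangentTrivialization

variable {E : Type*} [NormedAddCommGroup E] [NormedSpace ℝ E]
    {M : Type*} [TopologicalSpace M] [ChartedSpace E M] [IsManifold 𝓘(ℝ, E) ∞ M]

/-- The trivialization of the tangent bundle given by the preferred chart at `x₀`. -/
abbrev tangentTriv (x₀ : M) := trivializationAt E (TangentSpace 𝓘(ℝ, E) : M → Type _) x₀

/-- The coordinates, in the chart at `x₀`, of tangent vectors at `y`. It is an isomorphism when `y`
lies in the domain of the chart, and zero otherwise. -/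
abbrev toModel (x₀ y : M) : TangentSpace 𝓘(ℝ, E) y →L[ℝ] E :=
  (tangentTriv x₀).continuousLinearMapAt ℝ y

/-- The tangent vector at `y` with given coordinates in the chart at `x₀` (zero when `y` is outside
the domain of the chart). As a function of `y` it is a coordinate vector field with constant
coefficients. -/
abbrev ofModel (x₀ y : M) : E →L[ℝ] TangentSpace 𝓘(ℝ, E) y := (tangentTriv x₀).symmL ℝ y

/-- The expression of a vector field in the chart at `x₀`, as a map of the model space. Only its
values on the target of the chart are meaningful. -/
def coordField (x₀ : M) (Y : Π y : M, TangentSpace 𝓘(ℝ, E) y) (z : E) : E :=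
  toModel x₀ ((extChartAt 𝓘(ℝ, E) x₀).symm z) (Y ((extChartAt 𝓘(ℝ, E) x₀).symm z))

variable {x₀ y : M} {z : E}

theorem ofModel_toModel (hy : y ∈ (extChartAt 𝓘(ℝ, E) x₀).source) (v : TangentSpace 𝓘(ℝ, E) y) :
    ofModel x₀ y (toModel x₀ y v) = v :=
  (tangentTriv x₀).symmL_continuousLinearMapAt (R := ℝ) (by simpa using hy) v

theorem toModel_ofModel (hy : y ∈ (extChartAt 𝓘(ℝ, E) x₀).source) (a : E) :
    toModel x₀ y (ofModel x₀ y a) = a :=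
  (tangentTriv x₀).continuousLinearMapAt_symmL (R := ℝ) (by simpa using hy) a

theorem tangentTriv_snd (hy : y ∈ (extChartAt 𝓘(ℝ, E) x₀).source) (v : TangentSpace 𝓘(ℝ, E) y) :
    (tangentTriv x₀ ⟨y, v⟩).2 = toModel x₀ y v := by
  rw [toModel, Trivialization.continuousLinearMapAt_apply, Trivialization.coe_linearMapAt_of_mem]
  simpa using hy

theorem mfderiv_extChartAt_eq (hy : y ∈ (extChartAt 𝓘(ℝ, E) x₀).source) :
    mfderiv 𝓘(ℝ, E) 𝓘(ℝ, E) (extChartAt 𝓘(ℝ, E) x₀) y = toModel (E := E) x₀ y :=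
  (TangentBundle.continuousLinearMapAt_trivializationAt (I := 𝓘(ℝ, E)) (by simpa using hy)).symm

theorem mfderiv_extChartAt_inverse (hy : y ∈ (extChartAt 𝓘(ℝ, E) x₀).source) :
    (mfderiv 𝓘(ℝ, E) 𝓘(ℝ, E) (extChartAt 𝓘(ℝ, E) x₀) y).inverse = ofModel (E := E) x₀ y := by
  rw [mfderiv_extChartAt_eq (E := E) hy]
  have h1 : (toModel (E := E) x₀ y).comp (ofModel x₀ y) = .id ℝ E :=
    ContinuousLinearMap.ext fun a ↦ toModel_ofModel hy a
  have h2 : (ofModel x₀ y).comp (toModel (E := E) x₀ y) = .id ℝ (TangentSpace 𝓘(ℝ, E) y) :=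
    ContinuousLinearMap.ext fun v ↦ ofModel_toModel hy v
  exact ContinuousLinearMap.inverse_eq h1 h2

theorem mpullback_coordField (Y : Π y : M, TangentSpace 𝓘(ℝ, E) y)
    (hy : y ∈ (extChartAt 𝓘(ℝ, E) x₀).source) :
    mpullback 𝓘(ℝ, E) 𝓘(ℝ, E) (extChartAt 𝓘(ℝ, E) x₀) (coordField x₀ Y) y = Y y := by
  change (mfderiv 𝓘(ℝ, E) 𝓘(ℝ, E) (extChartAt 𝓘(ℝ, E) x₀) y).inverse
    (coordField (E := E) x₀ Y (extChartAt 𝓘(ℝ, E) x₀ y)) = Y y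
  rw [mfderiv_extChartAt_inverse hy]
  simp only [coordField]
  rw [(extChartAt 𝓘(ℝ, E) x₀).left_inv hy]
  exact ofModel_toModel hy _

theorem mdifferentiableAt_chart (hz : z ∈ (extChartAt 𝓘(ℝ, E) x₀).target) :
    MDifferentiableAt 𝓘(ℝ, E) 𝓘(ℝ, E) (extChartAt 𝓘(ℝ, E) x₀) ((extChartAt 𝓘(ℝ, E) x₀).symm z) :=
  mdifferentiableAt_extChartAt (by simpa using (extChartAt 𝓘(ℝ, E) x₀).map_target hz)

theorem mdifferentiableAt_chart_symm (hz : z ∈ (extChartAt 𝓘(ℝ, E) x₀).target) :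
    MDifferentiableAt 𝓘(ℝ, E) 𝓘(ℝ, E) (extChartAt 𝓘(ℝ, E) x₀).symm z := by
  have := mdifferentiableWithinAt_extChartAt_symm hz
  rwa [modelWithCornersSelf_coe, range_id, mdifferentiableWithinAt_univ] at this

omit [IsManifold 𝓘(ℝ, E) ∞ M] in
theorem target_mem_nhds (hz : z ∈ (extChartAt 𝓘(ℝ, E) x₀).target) :
    (extChartAt 𝓘(ℝ, E) x₀).target ∈ 𝓝 z := (isOpen_extChartAt_target x₀).mem_nhds hz

section

omit [IsManifold 𝓘(ℝ, E) ∞ M] in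
theorem eventuallyEq_comp_chart {F : Type*} (f : M → F) (hz : z ∈ (extChartAt 𝓘(ℝ, E) x₀).target) :
    f =ᶠ[𝓝 ((extChartAt 𝓘(ℝ, E) x₀).symm z)]
      (f ∘ (extChartAt 𝓘(ℝ, E) x₀).symm) ∘ extChartAt 𝓘(ℝ, E) x₀ := by
  filter_upwards [(isOpen_extChartAt_source x₀).mem_nhds ((extChartAt 𝓘(ℝ, E) x₀).map_target hz)]
    with y hy
  simp only [Function.comp, (extChartAt 𝓘(ℝ, E) x₀).left_inv hy]

variable {F : Type*} [NormedAddCommGroup F] [NormedSpace ℝ F]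

theorem mdifferentiableAt_iff_comp_chart_symm {f : M → F}
    (hz : z ∈ (extChartAt 𝓘(ℝ, E) x₀).target) :
    MDifferentiableAt 𝓘(ℝ, E) 𝓘(ℝ, F) f ((extChartAt 𝓘(ℝ, E) x₀).symm z) ↔
      DifferentiableAt ℝ (f ∘ (extChartAt 𝓘(ℝ, E) x₀).symm) z := by
  refine ⟨fun h ↦ ?_, fun h ↦ ?_⟩
  · exact (h.comp z (mdifferentiableAt_chart_symm hz)).differentiableAt
  · rw [(eventuallyEq_comp_chart f hz).mdifferentiableAt_iff]
    refine MDifferentiableAt.comp (I' := 𝓘(ℝ, E)) _ ?_ (mdifferentiableAt_chart hz)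
    rw [(extChartAt 𝓘(ℝ, E) x₀).right_inv hz]
    exact h.mdifferentiableAt

theorem mvfderiv_eq_fderiv {f : M → F} (hz : z ∈ (extChartAt 𝓘(ℝ, E) x₀).target)
    (hf : DifferentiableAt ℝ (f ∘ (extChartAt 𝓘(ℝ, E) x₀).symm) z)
    (v : TangentSpace 𝓘(ℝ, E) ((extChartAt 𝓘(ℝ, E) x₀).symm z)) :
    mvfderiv 𝓘(ℝ, E) f ((extChartAt 𝓘(ℝ, E) x₀).symm z) v
      = fderiv ℝ (f ∘ (extChartAt 𝓘(ℝ, E) x₀).symm) z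
        (toModel x₀ ((extChartAt 𝓘(ℝ, E) x₀).symm z) v) := by
  change mfderiv 𝓘(ℝ, E) 𝓘(ℝ, F) f ((extChartAt 𝓘(ℝ, E) x₀).symm z) v = _
  rw [(eventuallyEq_comp_chart f hz).mfderiv_eq,
    mfderiv_comp (I' := 𝓘(ℝ, E)) _ _ (mdifferentiableAt_chart hz)]
  · rw [mfderiv_extChartAt_eq ((extChartAt 𝓘(ℝ, E) x₀).map_target hz)]
    rw [(extChartAt 𝓘(ℝ, E) x₀).right_inv hz, mfderiv_eq_fderiv]
    rfl
  · rw [(extChartAt 𝓘(ℝ, E) x₀).right_inv hz]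
    exact hf.mdifferentiableAt

end

theorem mdifferentiableAt_iff_coordField {Y : Π y : M, TangentSpace 𝓘(ℝ, E) y}
    (hz : z ∈ (extChartAt 𝓘(ℝ, E) x₀).target) :
    MDifferentiableAt 𝓘(ℝ, E) 𝓘(ℝ, E).tangent (T% Y) ((extChartAt 𝓘(ℝ, E) x₀).symm z) ↔
      DifferentiableAt ℝ (coordField x₀ Y) z := by
  have hy := (extChartAt 𝓘(ℝ, E) x₀).map_target hz
  have h1 := (tangentTriv x₀).mdifferentiableAt_section_iff 𝓘(ℝ, E) Y
    (b₀ := (extChartAt 𝓘(ℝ, E) x₀).symm z) (by simpa using hy)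
  refine h1.trans ?_
  rw [mdifferentiableAt_iff_comp_chart_symm hz]
  refine Filter.EventuallyEq.differentiableAt_iff ?_
  filter_upwards [target_mem_nhds hz] with w hw
  exact tangentTriv_snd ((extChartAt 𝓘(ℝ, E) x₀).map_target hw) _

omit [TopologicalSpace M] [ChartedSpace E M] [IsManifold 𝓘(ℝ, E) ∞ M] in
/-- On a vector space, the bracket of the manifold library is the usual one. -/
theorem mlieBracket_model (V W : Π x : E, TangentSpace 𝓘(ℝ, E) x) :
    mlieBracket 𝓘(ℝ, E) V W = lieBracket ℝ V W := by
  rw [← mlieBracketWithin_univ, mlieBracketWithin_eq_lieBracketWithin]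
  exact lieBracketWithin_univ

/-- The Lie bracket in coordinates. Near the point both fields are pullbacks, under the chart, of
their coordinate expressions, and pullbacks commute with brackets. -/
theorem toModel_mlieBracket [CompleteSpace E] {X Y : Π y : M, TangentSpace 𝓘(ℝ, E) y}
    (hz : z ∈ (extChartAt 𝓘(ℝ, E) x₀).target)
    (hX : DifferentiableAt ℝ (coordField x₀ X) z) (hY : DifferentiableAt ℝ (coordField x₀ Y) z) :
    toModel x₀ ((extChartAt 𝓘(ℝ, E) x₀).symm z)
        (mlieBracket 𝓘(ℝ, E) X Y ((extChartAt 𝓘(ℝ, E) x₀).symm z))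
      = fderiv ℝ (coordField x₀ Y) z (coordField x₀ X z)
        - fderiv ℝ (coordField x₀ X) z (coordField x₀ Y z) := by
  have hy := (extChartAt 𝓘(ℝ, E) x₀).map_target hz
  have key (V : Π y : M, TangentSpace 𝓘(ℝ, E) y) : V =ᶠ[𝓝 ((extChartAt 𝓘(ℝ, E) x₀).symm z)]
      mpullback 𝓘(ℝ, E) 𝓘(ℝ, E) (extChartAt 𝓘(ℝ, E) x₀) (coordField x₀ V) := by
    filter_upwards [(isOpen_extChartAt_source x₀).mem_nhds hy] with y hy
    exact (mpullback_coordField V hy).symm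
  have md (V : E → E) (hV : DifferentiableAt ℝ V z) :
      MDifferentiableAt 𝓘(ℝ, E) 𝓘(ℝ, E).tangent (fun w ↦ (⟨w, V w⟩ : TangentBundle 𝓘(ℝ, E) E))
        (extChartAt 𝓘(ℝ, E) x₀ ((extChartAt 𝓘(ℝ, E) x₀).symm z)) := by
    rw [(extChartAt 𝓘(ℝ, E) x₀).right_inv hz]
    refine (mdifferentiableAt_totalSpace _ _).2 ⟨mdifferentiableAt_id, ?_⟩
    convert! hV.mdifferentiableAt with y
    simp
  have : IsManifold 𝓘(ℝ, E) (minSmoothness ℝ 2) M :=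
    IsManifold.of_le (n := ∞) (by simpa using ENat.LEInfty.out)
  rw [(key X).mlieBracket_vectorField_eq (key Y)]
  have := mpullback_mlieBracket (I := 𝓘(ℝ, E)) (I' := 𝓘(ℝ, E)) (n := 2)
    (md _ hX) (md _ hY) (x₀ := (extChartAt 𝓘(ℝ, E) x₀).symm z)
    (contMDiffAt_extChartAt' (by simpa using hy)) (by simp)
  rw [← this]
  refine (congrArg (fun A : E →L[ℝ] TangentSpace 𝓘(ℝ, E) ((extChartAt 𝓘(ℝ, E) x₀).symm z) ↦
    toModel x₀ _ (A (mlieBracket 𝓘(ℝ, E) (coordField x₀ X) (coordField x₀ Y)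
      ((extChartAt 𝓘(ℝ, E) x₀) ((extChartAt 𝓘(ℝ, E) x₀).symm z)))))
    (mfderiv_extChartAt_inverse hy)).trans ?_
  refine (toModel_ofModel hy _).trans ?_
  rw [(extChartAt 𝓘(ℝ, E) x₀).right_inv hz]
  exact congrFun (mlieBracket_model (coordField x₀ X) (coordField x₀ Y)) z

end TangentTrivialization

/-! ### The Christoffel symbols of a metric on a vector space -/

section Christoffel

-- Instance search on iterated spaces of continuous linear maps exceeds the default depth.
set_option maxSynthPendingDepth 3
set_option synthInstance.maxHeartbeats 100000

variable {E : Type*} [NormedAddCommGroup E] [NormedSpace ℝ E]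

/-- The Christoffel symbols of the first kind, as a function of the derivative `T` of the metric. -/
def christoffelLower (T : E →L[ℝ] E →L[ℝ] E →L[ℝ] ℝ) : E →L[ℝ] E →L[ℝ] E →L[ℝ] ℝ :=
  (1 / 2 : ℝ) • (T + T.flip
    - ((ContinuousLinearMap.flipₗᵢ ℝ E E ℝ).toContinuousLinearEquiv :
        (E →L[ℝ] E →L[ℝ] ℝ) →L[ℝ] E →L[ℝ] E →L[ℝ] ℝ).comp T.flip)

theorem christoffelLower_apply (T : E →L[ℝ] E →L[ℝ] E →L[ℝ] ℝ) (a b c : E) :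
    christoffelLower T a b c = (1 / 2) * (T a b c + T b a c - T c a b) := by
  simp [christoffelLower]

theorem contDiff_christoffelLower {n : ℕ∞ω} :
    ContDiff ℝ n (christoffelLower : (E →L[ℝ] E →L[ℝ] E →L[ℝ] ℝ) → _) := by
  have hflip : ContDiff ℝ n (fun T : E →L[ℝ] E →L[ℝ] E →L[ℝ] ℝ ↦ T.flip) :=
    (ContinuousLinearMap.flipₗᵢ ℝ E E (E →L[ℝ] ℝ)).contDiff
  unfold christoffelLower
  exact ((contDiff_id.add hflip).sub (contDiff_const.clm_comp hflip)).const_smul _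

/-- The Christoffel symbols of the second kind `Γ(a, b)` of the metric `g` at `z`. They are
meaningful only where `g z` is invertible as a map from `E` to its dual. -/
def christoffel (g : E → E →L[ℝ] E →L[ℝ] ℝ) (z : E) : E →L[ℝ] E →L[ℝ] E :=
  (ContinuousLinearMap.compL ℝ E (E →L[ℝ] ℝ) E (g z).inverse).comp
    (christoffelLower (fderiv ℝ g z))

variable {g : E → E →L[ℝ] E →L[ℝ] ℝ} {z : E}

theorem metric_christoffel (hg : (g z).IsInvertible) (a b c : E) :
    g z (christoffel g z a b) c
      = (1 / 2) * (fderiv ℝ g z a b c + fderiv ℝ g z b a c - fderiv ℝ g z c a b) := by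
  rw [← christoffelLower_apply]
  simp [christoffel, hg.self_apply_inverse]

theorem differentiableAt_christoffel [CompleteSpace E] (hg : (g z).IsInvertible)
    (h : ContDiffAt ℝ 2 g z) : DifferentiableAt ℝ (christoffel g) z := by
  obtain ⟨e, he⟩ := hg
  have h1 : ContDiffAt ℝ 1 (fun w ↦ (g w).inverse) z := by
    have := contDiffAt_map_inverse (n := 1) e
    rw [he] at this
    exact this.comp z (h.of_le one_le_two)
  have h2 : ContDiffAt ℝ 1 (fun w ↦ christoffelLower (fderiv ℝ g w)) z :=
    contDiff_christoffelLower.contDiffAt.comp z (h.fderiv_right (m := 1) (by norm_num))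
  have h3 : ContDiffAt ℝ 1
      (fun w ↦ ContinuousLinearMap.compL ℝ E (E →L[ℝ] ℝ) E (g w).inverse) z :=
    (ContinuousLinearMap.compL ℝ E (E →L[ℝ] ℝ) E).contDiff.contDiffAt.comp z h1
  exact (h3.clm_comp h2).differentiableAt one_ne_zero

theorem fderiv_apply_symm (hs : ∀ᶠ w in 𝓝 z, ∀ a b, g w a b = g w b a)
    (h : DifferentiableAt ℝ g z) (a b c : E) : fderiv ℝ g z a b c = fderiv ℝ g z a c b := by
  have key (b c : E) : fderiv ℝ (fun w ↦ g w b c) z a = fderiv ℝ g z a b c := by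
    have := ((h.hasFDerivAt.clm_apply (hasFDerivAt_const b z)).clm_apply
      (hasFDerivAt_const c z)).fderiv
    rw [this]; simp
  rw [← key, ← key]
  have : (fun w ↦ g w b c) =ᶠ[𝓝 z] fun w ↦ g w c b := hs.mono fun w hw ↦ hw b c
  rw [this.fderiv_eq]

/-- The Christoffel symbols define a connection which preserves the metric. -/
theorem fderiv_metric (hs : ∀ᶠ w in 𝓝 z, ∀ a b, g w a b = g w b a)
    (h : DifferentiableAt ℝ g z) (hg : (g z).IsInvertible) (a b c : E) :
    fderiv ℝ g z a b c = g z (christoffel g z a b) c + g z (christoffel g z a c) b := by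
  rw [metric_christoffel hg, metric_christoffel hg, fderiv_apply_symm hs h a c b]
  ring

theorem christoffel_comm (hs : ∀ᶠ w in 𝓝 z, ∀ a b, g w a b = g w b a)
    (h : DifferentiableAt ℝ g z) (a b : E) :
    christoffel g z a b = christoffel g z b a := by
  have : christoffelLower (fderiv ℝ g z) a b = christoffelLower (fderiv ℝ g z) b a := by
    ext c
    simp only [christoffelLower_apply, fderiv_apply_symm hs h c a b]
    ring
  simp [christoffel, this]

end Christoffel

/-! ### The Levi-Civita connection in a chart -/

section MetricInChart

set_option maxSynthPendingDepth 3
set_option synthInstance.maxHeartbeats 100000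

variable {E : Type*} [NormedAddCommGroup E] [NormedSpace ℝ E]
    {M : Type*} [TopologicalSpace M] [ChartedSpace E M] [IsManifold 𝓘(ℝ, E) ∞ M]
  {x₀ : M} {z : E}

theorem coordField_ofModel (a : E) (hz : z ∈ (extChartAt 𝓘(ℝ, E) x₀).target) :
    coordField x₀ (fun y ↦ ofModel x₀ y a) z = a :=
  toModel_ofModel ((extChartAt 𝓘(ℝ, E) x₀).map_target hz) a

theorem coordField_ofModel_eventuallyEq (a : E) (hz : z ∈ (extChartAt 𝓘(ℝ, E) x₀).target) :
    coordField x₀ (fun y ↦ ofModel x₀ y a) =ᶠ[𝓝 z] fun _ ↦ a := by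
  filter_upwards [target_mem_nhds hz] with w hw using coordField_ofModel a hw

theorem contMDiffOn_ofModel (a : E) : ContMDiffOn 𝓘(ℝ, E) (𝓘(ℝ, E).tangent) ∞
    (fun y : M ↦ (⟨y, ofModel x₀ y a⟩ : TangentBundle 𝓘(ℝ, E) M))
    (extChartAt 𝓘(ℝ, E) x₀).source := by
  refine (Trivialization.contMDiffOn_section_iff (tangentTriv x₀) (isOpen_extChartAt_source x₀)
    (by simp)).2 ?_
  refine (contMDiffOn_const (c := a)).congr fun y hy ↦ ?_
  rw [tangentTriv_snd hy, toModel_ofModel hy]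

variable [RiemannianBundle (fun x : M ↦ TangentSpace 𝓘(ℝ, E) x)]

/-- The Riemannian metric in the chart at `x₀`, as a field of bilinear forms on the model space. -/
def localMetric (x₀ : M) (z : E) : E →L[ℝ] E →L[ℝ] ℝ :=
  (innerSL ℝ (E := TangentSpace 𝓘(ℝ, E) ((extChartAt 𝓘(ℝ, E) x₀).symm z))).bilinearComp
    (ofModel x₀ ((extChartAt 𝓘(ℝ, E) x₀).symm z)) (ofModel x₀ ((extChartAt 𝓘(ℝ, E) x₀).symm z))

theorem localMetric_apply (a b : E) :
    localMetric x₀ z a b = inner ℝ (ofModel x₀ ((extChartAt 𝓘(ℝ, E) x₀).symm z) a)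
      (ofModel x₀ ((extChartAt 𝓘(ℝ, E) x₀).symm z) b) := rfl

theorem localMetric_toModel (hz : z ∈ (extChartAt 𝓘(ℝ, E) x₀).target)
    (v w : TangentSpace 𝓘(ℝ, E) ((extChartAt 𝓘(ℝ, E) x₀).symm z)) :
    localMetric x₀ z (toModel x₀ _ v) (toModel x₀ _ w) = inner ℝ v w := by
  have hy := (extChartAt 𝓘(ℝ, E) x₀).map_target hz
  rw [localMetric_apply, ofModel_toModel hy, ofModel_toModel hy]

theorem localMetric_comm (a b : E) : localMetric x₀ z a b = localMetric x₀ z b a := by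
  rw [localMetric_apply, localMetric_apply, real_inner_comm]

theorem localMetric_injective (hz : z ∈ (extChartAt 𝓘(ℝ, E) x₀).target) :
    Function.Injective (localMetric x₀ z) := by
  refine (injective_iff_map_eq_zero _).2 fun a ha ↦ ?_
  have h : localMetric x₀ z a a = 0 := by simp [ha]
  rw [localMetric_apply, inner_self_eq_zero] at h
  have hy := (extChartAt 𝓘(ℝ, E) x₀).map_target hz
  rw [← toModel_ofModel hy a, h, map_zero]

theorem isInvertible_localMetric [FiniteDimensional ℝ E]
    (hz : z ∈ (extChartAt 𝓘(ℝ, E) x₀).target) : (localMetric x₀ z).IsInvertible := by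
  have hdim : Module.finrank ℝ E = Module.finrank ℝ (E →L[ℝ] ℝ) := by
    rw [← (LinearMap.toContinuousLinearMap (𝕜 := ℝ) (E := E) (F' := ℝ)).finrank_eq]
    exact (Subspace.dual_finrank_eq (K := ℝ) (V := E)).symm
  exact ⟨(LinearEquiv.ofInjectiveOfFinrankEq (localMetric x₀ z : E →ₗ[ℝ] E →L[ℝ] ℝ)
    (localMetric_injective hz) hdim).toContinuousLinearEquiv, by ext; rfl⟩

variable [FiniteDimensional ℝ E]
    [IsContMDiffRiemannianBundle 𝓘(ℝ, E) ∞ E (fun x : M ↦ TangentSpace 𝓘(ℝ, E) x)]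

theorem contDiffOn_localMetric :
    ContDiffOn ℝ ∞ (localMetric x₀) (extChartAt 𝓘(ℝ, E) x₀).target := by
  refine contDiffOn_clm_apply.2 fun a ↦ contDiffOn_clm_apply.2 fun b ↦ ?_
  have h : ContMDiffOn 𝓘(ℝ, E) 𝓘(ℝ, ℝ) ∞ (metricPairing 𝓘(ℝ, E) (fun y ↦ ofModel x₀ y a)
      (fun y ↦ ofModel x₀ y b)) (extChartAt 𝓘(ℝ, E) x₀).source :=
    ContMDiffOn.inner_bundle (F := E) (E := fun x : M ↦ TangentSpace 𝓘(ℝ, E) x)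
      (b := fun x ↦ x) (contMDiffOn_ofModel a) (contMDiffOn_ofModel b)
  exact (h.comp (contMDiffOn_extChartAt_symm x₀)
    fun w hw ↦ (extChartAt 𝓘(ℝ, E) x₀).map_target hw).contDiffOn

theorem differentiableAt_localMetric (hz : z ∈ (extChartAt 𝓘(ℝ, E) x₀).target) :
    DifferentiableAt ℝ (localMetric x₀) z :=
  (contDiffOn_localMetric.contDiffAt (target_mem_nhds hz)).differentiableAt (by simp)

theorem differentiableAt_christoffel_localMetric (hz : z ∈ (extChartAt 𝓘(ℝ, E) x₀).target) :
    DifferentiableAt ℝ (christoffel (localMetric x₀)) z :=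
  have := FiniteDimensional.complete ℝ E
  differentiableAt_christoffel (isInvertible_localMetric hz)
    ((contDiffOn_localMetric.contDiffAt (target_mem_nhds hz)).of_le
      (by simpa using ENat.LEInfty.out))

theorem mvfderiv_metricPairing {V W : Π y : M, TangentSpace 𝓘(ℝ, E) y}
    (hz : z ∈ (extChartAt 𝓘(ℝ, E) x₀).target)
    (hV : DifferentiableAt ℝ (coordField x₀ V) z) (hW : DifferentiableAt ℝ (coordField x₀ W) z)
    (v : TangentSpace 𝓘(ℝ, E) ((extChartAt 𝓘(ℝ, E) x₀).symm z)) :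
    mvfderiv 𝓘(ℝ, E) (metricPairing 𝓘(ℝ, E) V W) ((extChartAt 𝓘(ℝ, E) x₀).symm z) v
      = fderiv ℝ (localMetric x₀) z (toModel x₀ _ v) (coordField x₀ V z) (coordField x₀ W z)
        + localMetric x₀ z (fderiv ℝ (coordField x₀ V) z (toModel x₀ _ v)) (coordField x₀ W z)
        + localMetric x₀ z (coordField x₀ V z) (fderiv ℝ (coordField x₀ W) z (toModel x₀ _ v)) := by
  have heq : metricPairing 𝓘(ℝ, E) V W ∘ (extChartAt 𝓘(ℝ, E) x₀).symm =ᶠ[𝓝 z]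
      fun w ↦ localMetric x₀ w (coordField x₀ V w) (coordField x₀ W w) := by
    filter_upwards [target_mem_nhds hz] with w hw
    exact (localMetric_toModel hw _ _).symm
  have hd := ((differentiableAt_localMetric hz).hasFDerivAt.clm_apply hV.hasFDerivAt).clm_apply
    hW.hasFDerivAt
  rw [mvfderiv_eq_fderiv hz (heq.differentiableAt_iff.2 hd.differentiableAt), heq.fderiv_eq,
    hd.fderiv]
  simp
  ring

/-- The Levi-Civita connection in coordinates: `∇_v Y = DY(v) + Γ(v, Y)`. Both sides have the same
scalar product with every constant field, by the Koszul formula for constant fields extending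
`v` and the test vector. -/
theorem toModel_leviCivita {Y : Π y : M, TangentSpace 𝓘(ℝ, E) y}
    (hz : z ∈ (extChartAt 𝓘(ℝ, E) x₀).target) (hY : DifferentiableAt ℝ (coordField x₀ Y) z)
    (v : TangentSpace 𝓘(ℝ, E) ((extChartAt 𝓘(ℝ, E) x₀).symm z)) :
    toModel x₀ _ (leviCivita 𝓘(ℝ, E) M Y ((extChartAt 𝓘(ℝ, E) x₀).symm z) v)
      = fderiv ℝ (coordField x₀ Y) z (toModel x₀ _ v)
        + christoffel (localMetric x₀) z (toModel x₀ _ v) (coordField x₀ Y z) := by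
  have := FiniteDimensional.complete ℝ E
  have hy := (extChartAt 𝓘(ℝ, E) x₀).map_target hz
  refine localMetric_injective hz (ContinuousLinearMap.ext fun c ↦ ?_)
  set a := toModel x₀ _ v
  let X : Π y : M, TangentSpace 𝓘(ℝ, E) y := fun y ↦ ofModel x₀ y a
  let Z : Π y : M, TangentSpace 𝓘(ℝ, E) y := fun y ↦ ofModel x₀ y c
  have eX := coordField_ofModel_eventuallyEq a hz
  have eZ := coordField_ofModel_eventuallyEq c hz
  have dX : DifferentiableAt ℝ (coordField x₀ X) z :=
    eX.differentiableAt_iff.2 (differentiableAt_const _)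
  have dZ : DifferentiableAt ℝ (coordField x₀ Z) z :=
    eZ.differentiableAt_iff.2 (differentiableAt_const _)
  have fX : fderiv ℝ (coordField x₀ X) z = 0 := eX.fderiv_eq.trans (fderiv_const_apply a)
  have fZ : fderiv ℝ (coordField x₀ Z) z = 0 := eZ.fderiv_eq.trans (fderiv_const_apply c)
  have hXz : coordField x₀ X z = a := eX.eq_of_nhds
  have hZz : coordField x₀ Z z = c := eZ.eq_of_nhds
  have hXv : X ((extChartAt 𝓘(ℝ, E) x₀).symm z) = v := ofModel_toModel hy v
  have tZ : toModel x₀ _ (Z ((extChartAt 𝓘(ℝ, E) x₀).symm z)) = c := hZz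
  have tY : toModel x₀ _ (Y ((extChartAt 𝓘(ℝ, E) x₀).symm z)) = coordField x₀ Y z := rfl
  have h1 := inner_leviCivita ((mdifferentiableAt_iff_coordField hz).2 dX)
    ((mdifferentiableAt_iff_coordField hz).2 hY) ((mdifferentiableAt_iff_coordField hz).2 dZ)
  simp only [koszul, mvfderiv_metricPairing hz hY dZ, mvfderiv_metricPairing hz dZ dX,
    mvfderiv_metricPairing hz dX hY, ← localMetric_toModel hz, toModel_mlieBracket hz dX hY,
    toModel_mlieBracket hz hY dZ, toModel_mlieBracket hz dZ dX, tY, tZ, fX, fZ, hXz, hZz,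
    hXv] at h1
  simp only [map_add, add_apply, metric_christoffel (isInvertible_localMetric hz)]
  simp only [map_zero, zero_apply, sub_zero, zero_sub, map_neg, neg_apply, add_zero] at h1
  -- the remaining discrepancies are exchanges of arguments in `g` and in its derivative
  have s1 := localMetric_comm (x₀ := x₀) (z := z) a (fderiv ℝ (coordField x₀ Y) z c)
  have s2 := fderiv_apply_symm (g := localMetric x₀) (z := z)
    (Filter.Eventually.of_forall fun w a b ↦ localMetric_comm a b)
    (differentiableAt_localMetric hz) (coordField x₀ Y z) c a
  linarith

end MetricInChart

/-! ### Calculus of the flow in coordinates -/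

section FluidInChart

set_option maxSynthPendingDepth 3
set_option synthInstance.maxHeartbeats 100000

variable {E : Type*} [NormedAddCommGroup E] [NormedSpace ℝ E]

/-- The derivative of `⟨V, W⟩` along a curve, through the covariant derivatives of `V` and `W` along
that curve. -/
theorem hasDerivAt_metric_curve {g : E → E →L[ℝ] E →L[ℝ] ℝ} {x V W : ℝ → E} {v V' W' : E} {t : ℝ}
    (hs : ∀ᶠ w in 𝓝 (x t), ∀ a b, g w a b = g w b a) (h : DifferentiableAt ℝ g (x t))
    (hg : (g (x t)).IsInvertible) (hx : HasDerivAt x v t) (hV : HasDerivAt V V' t)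
    (hW : HasDerivAt W W' t) :
    HasDerivAt (fun τ ↦ g (x τ) (V τ) (W τ))
      (g (x t) (V' + christoffel g (x t) v (V t)) (W t)
        + g (x t) (V t) (W' + christoffel g (x t) v (W t))) t := by
  have h1 := ((h.hasFDerivAt.comp_hasDerivAt t hx).clm_apply hV).clm_apply hW
  refine h1.congr_deriv ?_
  have h2 := fderiv_metric hs h hg v (V t) (W t)
  have h3 := hs.self_of_nhds (V t) (christoffel g (x t) v (W t))
  simp only [add_apply, map_add, h2, h3, Function.comp]
  ring

/-- If `∂Φ/∂t = U(t, Φ)`, then `ξ = ∂Φ/∂s` solves the linearized equation `ξ' = DU(ξ)`, because the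
mixed second derivatives of `Φ` agree. -/
theorem hasDerivAt_fderiv_flow {U : ℝ × E → E} {Φ : ℝ × ℝ → E} {t : ℝ}
    (hU : DifferentiableAt ℝ U (t, Φ (0, t))) (hΦ : ContDiffAt ℝ 2 Φ (0, t))
    (hflow : ∀ᶠ q : ℝ × ℝ in 𝓝 (0, t), fderiv ℝ Φ q (0, 1) = U (q.2, Φ q)) :
    HasDerivAt (fun τ ↦ fderiv ℝ Φ (0, τ) (1, 0))
      (fderiv ℝ U (t, Φ (0, t)) (0, fderiv ℝ Φ (0, t) (1, 0))) t := by
  have hd : DifferentiableAt ℝ (fderiv ℝ Φ) (0, t) :=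
    (hΦ.fderiv_right (m := 1) (by norm_num)).differentiableAt one_ne_zero
  have hline : HasDerivAt (fun τ : ℝ ↦ ((0 : ℝ), τ)) (0, 1) t :=
    (hasDerivAt_const t (0 : ℝ)).prodMk (hasDerivAt_id t)
  have h1 := (hd.hasFDerivAt.comp_hasDerivAt t hline).clm_apply
    (hasDerivAt_const t ((1 : ℝ), (0 : ℝ)))
  refine h1.congr_deriv ?_
  have hsymm := (hΦ.isSymmSndFDerivAt (by simp)) (0, 1) (1, 0)
  have hΦ' := (hΦ.differentiableAt two_ne_zero).hasFDerivAt
  have h2 : HasFDerivAt (fun q : ℝ × ℝ ↦ U (q.2, Φ q)) _ (0, t) :=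
    HasFDerivAt.comp (g := U) (f := fun q : ℝ × ℝ ↦ (q.2, Φ q)) (0, t) hU.hasFDerivAt
      (hasFDerivAt_snd.prodMk hΦ')
  have h3 := hd.hasFDerivAt.clm_apply (hasFDerivAt_const ((0 : ℝ), (1 : ℝ)) ((0 : ℝ), t))
  have h4 := (h2.congr_of_eventuallyEq hflow).unique h3
  have h5 := congrArg (fun A : ℝ × ℝ →L[ℝ] E ↦ A (1, 0)) h4
  simp at h5
  simp [hsymm, h5]

/-- The spatial derivative, in a direction `a`, of the coordinate form
`∂U/∂t + DU(U) + Γ(U, U) = -P` of the momentum equation. -/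
theorem fderiv_momentum {U : ℝ × E → E} {Γ : E → E →L[ℝ] E →L[ℝ] E} {P : E → E} {z : E} {t : ℝ}
    (hU : ContDiffAt ℝ 2 U (t, z)) (hΓ : DifferentiableAt ℝ Γ z)
    (hP : ∀ᶠ w in 𝓝 z, fderiv ℝ U (t, w) (1, 0) + (fderiv ℝ U (t, w) (0, U (t, w))
      + Γ w (U (t, w)) (U (t, w))) = -P w) :
    DifferentiableAt ℝ P z ∧ ∀ a : E, -fderiv ℝ P z a
      = fderiv ℝ (fderiv ℝ U) (t, z) (0, a) (1, 0)
        + (fderiv ℝ (fderiv ℝ U) (t, z) (0, a) (0, U (t, z))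
          + fderiv ℝ U (t, z) (0, fderiv ℝ U (t, z) (0, a))
          + (fderiv ℝ Γ z a (U (t, z)) (U (t, z))
            + Γ z (fderiv ℝ U (t, z) (0, a)) (U (t, z))
            + Γ z (U (t, z)) (fderiv ℝ U (t, z) (0, a)))) := by
  have hd : DifferentiableAt ℝ (fderiv ℝ U) (t, z) :=
    (hU.fderiv_right (m := 1) (by norm_num)).differentiableAt one_ne_zero
  have hslice : HasFDerivAt (fun z : E ↦ (t, z)) (ContinuousLinearMap.inr ℝ ℝ E) z :=
    hasFDerivAt_prodMk_right t z
  have sD : HasFDerivAt (fun z : E ↦ fderiv ℝ U (t, z)) _ z := hd.hasFDerivAt.comp z hslice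
  have sU : HasFDerivAt (fun z : E ↦ U (t, z)) _ z :=
    (hU.differentiableAt two_ne_zero).hasFDerivAt.comp z hslice
  have s1 := sD.clm_apply (hasFDerivAt_const ((1 : ℝ), (0 : E)) z)
  have s2 := sD.clm_apply ((hasFDerivAt_const (0 : ℝ) z).prodMk sU)
  have s3 := (hΓ.hasFDerivAt.clm_apply sU).clm_apply sU
  have sP := (s1.add (s2.add s3)).neg.congr_of_eventuallyEq
    (f₁ := P) (hP.mono fun z hz ↦ by simp only [Pi.neg_apply, Pi.add_apply, hz, neg_neg])
  refine ⟨sP.differentiableAt, fun a ↦ ?_⟩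
  rw [sP.fderiv]
  simp
  abel

/-- The derivative of `∇_ξ U = DU(ξ) + Γ(ξ, U)` along a curve `x` of velocity `v`, where `ξ` is a
field along the curve of derivative `η`. -/
theorem hasDerivAt_velocityGradient {U : ℝ × E → E} {Γ : E → E →L[ℝ] E →L[ℝ] E}
    {x ξ : ℝ → E} {t : ℝ} {v η : E} (hU : ContDiffAt ℝ 2 U (t, x t))
    (hΓ : DifferentiableAt ℝ Γ (x t)) (hx : HasDerivAt x v t) (hξ : HasDerivAt ξ η t) :
    HasDerivAt (fun τ ↦ fderiv ℝ U (τ, x τ) (0, ξ τ) + Γ (x τ) (ξ τ) (U (τ, x τ)))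
      (fderiv ℝ (fderiv ℝ U) (t, x t) (0, ξ t) (1, 0)
        + fderiv ℝ (fderiv ℝ U) (t, x t) (0, ξ t) (0, v)
        + fderiv ℝ U (t, x t) (0, η)
        + (fderiv ℝ Γ (x t) v (ξ t) (U (t, x t)) + Γ (x t) η (U (t, x t))
          + Γ (x t) (ξ t) (fderiv ℝ U (t, x t) (1, 0) + fderiv ℝ U (t, x t) (0, v)))) t := by
  have hd : DifferentiableAt ℝ (fderiv ℝ U) (t, x t) :=
    (hU.fderiv_right (m := 1) (by norm_num)).differentiableAt one_ne_zero
  have hcurve : HasDerivAt (fun τ ↦ (τ, x τ)) ((1 : ℝ), v) t := (hasDerivAt_id t).prodMk hx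
  have cD : HasDerivAt (fun τ ↦ fderiv ℝ U (τ, x τ)) (fderiv ℝ (fderiv ℝ U) (t, x t) (1, v)) t :=
    hd.hasFDerivAt.comp_hasDerivAt t hcurve
  have cU : HasDerivAt (fun τ ↦ U (τ, x τ)) (fderiv ℝ U (t, x t) (1, v)) t :=
    (hU.differentiableAt two_ne_zero).hasFDerivAt.comp_hasDerivAt t hcurve
  have cΓ : HasDerivAt (fun τ ↦ Γ (x τ)) (fderiv ℝ Γ (x t) v) t :=
    hΓ.hasFDerivAt.comp_hasDerivAt t hx
  have c0 : HasDerivAt (fun τ ↦ ((0 : ℝ), ξ τ)) (0, η) t := (hasDerivAt_const t (0 : ℝ)).prodMk hξ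
  have split {F : Type _} [NormedAddCommGroup F] [NormedSpace ℝ F] (A : ℝ × E →L[ℝ] F) :
      A (1, v) = A (1, 0) + A (0, v) := by
    rw [← map_add, Prod.mk_add_mk, add_zero, zero_add]
  refine ((cD.clm_apply c0).add ((cΓ.clm_apply hξ).clm_apply cU)).congr_deriv ?_
  have hsymm := (hU.isSymmSndFDerivAt (by simp)) (1, v) (0, ξ t)
  rw [hsymm, split, split, add_apply]

/-- Along a trajectory, the covariant derivative of `∇_ξ U` is `-∇_ξ P - R(ξ, U) U`: in coordinates,
the second derivatives of `U` cancel against those in the spatial derivative of the momentum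
equation, and the derivatives and squares of `Γ` that remain form the curvature. -/
theorem hasDerivAt_velocityGradient_euler {U : ℝ × E → E} {Γ : E → E →L[ℝ] E →L[ℝ] E} {P : E → E}
    {x ξ : ℝ → E} {t : ℝ} (hU : ContDiffAt ℝ 2 U (t, x t)) (hΓ : DifferentiableAt ℝ Γ (x t))
    (hs : ∀ a b, Γ (x t) a b = Γ (x t) b a)
    (hx : HasDerivAt x (U (t, x t)) t) (hξ : HasDerivAt ξ (fderiv ℝ U (t, x t) (0, ξ t)) t)
    (hP : ∀ᶠ z in 𝓝 (x t), fderiv ℝ U (t, z) (1, 0) + (fderiv ℝ U (t, z) (0, U (t, z))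
      + Γ z (U (t, z)) (U (t, z))) = -P z) :
    HasDerivAt (fun τ ↦ fderiv ℝ U (τ, x τ) (0, ξ τ) + Γ (x τ) (ξ τ) (U (τ, x τ)))
      (-(fderiv ℝ P (x t) (ξ t) + Γ (x t) (ξ t) (P (x t)))
        - (fderiv ℝ Γ (x t) (ξ t) (U (t, x t)) (U (t, x t))
          + Γ (x t) (ξ t) (Γ (x t) (U (t, x t)) (U (t, x t)))
          - (fderiv ℝ Γ (x t) (U (t, x t)) (ξ t) (U (t, x t))
          + Γ (x t) (U (t, x t)) (Γ (x t) (ξ t) (U (t, x t)))))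
        - Γ (x t) (U (t, x t)) (fderiv ℝ U (t, x t) (0, ξ t) + Γ (x t) (ξ t) (U (t, x t)))) t := by
  refine (hasDerivAt_velocityGradient hU hΓ hx hξ).congr_deriv ?_
  have hP0 : fderiv ℝ U (t, x t) (1, 0) + fderiv ℝ U (t, x t) (0, U (t, x t))
      = -P (x t) - Γ (x t) (U (t, x t)) (U (t, x t)) := by
    rw [← hP.self_of_nhds]; abel
  rw [hP0, neg_add, (fderiv_momentum hU hΓ hP).2 (ξ t),
    hs (U (t, x t)) (fderiv ℝ U (t, x t) (0, ξ t)), map_add,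
    hs (U (t, x t)) (fderiv ℝ U (t, x t) (0, ξ t)), map_sub, map_neg]
  abel

end FluidInChart

/-! ### The curvature in a chart -/

section CurvatureInChart

set_option maxSynthPendingDepth 3
set_option synthInstance.maxHeartbeats 100000

variable {E : Type*} [NormedAddCommGroup E] [NormedSpace ℝ E]
    {M : Type*} [TopologicalSpace M] [ChartedSpace E M] [IsManifold 𝓘(ℝ, E) ∞ M]
  {x₀ y : M} {z : E}

omit [IsManifold 𝓘(ℝ, E) ∞ M] in
theorem exists_chart_symm_eq (hy : y ∈ (extChartAt 𝓘(ℝ, E) x₀).source) :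
    ∃ z ∈ (extChartAt 𝓘(ℝ, E) x₀).target, (extChartAt 𝓘(ℝ, E) x₀).symm z = y :=
  ⟨_, (extChartAt 𝓘(ℝ, E) x₀).map_source hy, (extChartAt 𝓘(ℝ, E) x₀).left_inv hy⟩

theorem coordField_chart (Y : Π y : M, TangentSpace 𝓘(ℝ, E) y)
    (hy : y ∈ (extChartAt 𝓘(ℝ, E) x₀).source) :
    coordField x₀ Y (extChartAt 𝓘(ℝ, E) x₀ y) = toModel x₀ y (Y y) := by
  obtain ⟨z, hz, rfl⟩ := exists_chart_symm_eq hy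
  rw [(extChartAt 𝓘(ℝ, E) x₀).right_inv hz]
  rfl

theorem toModel_injective (hy : y ∈ (extChartAt 𝓘(ℝ, E) x₀).source) :
    Function.Injective (toModel (E := E) x₀ y) :=
  Function.LeftInverse.injective (g := ofModel x₀ y) (ofModel_toModel hy)

/-- The extension of a tangent vector at `x₀` which enters the definition of the curvature is a
coordinate field with constant coefficients near `x₀`. -/
theorem coordField_extend_eventuallyEq (v : TangentSpace 𝓘(ℝ, E) x₀) :
    coordField x₀ (extend E v) =ᶠ[𝓝 (extChartAt 𝓘(ℝ, E) x₀ x₀)] fun _ ↦ toModel x₀ x₀ v := by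
  filter_upwards [extChartAt_target_mem_nhds x₀] with z hz
  have hy := (extChartAt 𝓘(ℝ, E) x₀).map_target hz
  have h := toModel_ofModel hy (toModel x₀ x₀ v)
  rw [← tangentTriv_snd (mem_extChartAt_source x₀)] at h ⊢
  exact (congrArg (toModel x₀ _)
    ((tangentTriv x₀).symmL_apply (R := ℝ) (by simpa using hy) _).symm).trans h

variable [RiemannianBundle (fun x : M ↦ TangentSpace 𝓘(ℝ, E) x)]

theorem localMetric_chart (hy : y ∈ (extChartAt 𝓘(ℝ, E) x₀).source)
    (v w : TangentSpace 𝓘(ℝ, E) y) :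
    localMetric x₀ (extChartAt 𝓘(ℝ, E) x₀ y) (toModel x₀ y v) (toModel x₀ y w) = inner ℝ v w := by
  obtain ⟨z, hz, rfl⟩ := exists_chart_symm_eq hy
  rw [(extChartAt 𝓘(ℝ, E) x₀).right_inv hz, localMetric_toModel hz]

variable [FiniteDimensional ℝ E]
    [IsContMDiffRiemannianBundle 𝓘(ℝ, E) ∞ E (fun x : M ↦ TangentSpace 𝓘(ℝ, E) x)]

theorem toModel_leviCivita_chart {Y : Π y : M, TangentSpace 𝓘(ℝ, E) y}
    (hy : y ∈ (extChartAt 𝓘(ℝ, E) x₀).source)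
    (hY : DifferentiableAt ℝ (coordField x₀ Y) (extChartAt 𝓘(ℝ, E) x₀ y))
    (v : TangentSpace 𝓘(ℝ, E) y) :
    toModel x₀ y (leviCivita 𝓘(ℝ, E) M Y y v)
      = fderiv ℝ (coordField x₀ Y) (extChartAt 𝓘(ℝ, E) x₀ y) (toModel x₀ y v)
        + christoffel (localMetric x₀) (extChartAt 𝓘(ℝ, E) x₀ y) (toModel x₀ y v)
          (toModel x₀ y (Y y)) := by
  rw [← coordField_chart Y hy]
  obtain ⟨z, hz, rfl⟩ := exists_chart_symm_eq hy
  rw [(extChartAt 𝓘(ℝ, E) x₀).right_inv hz] at hY ⊢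
  exact toModel_leviCivita hz hY v

theorem coordField_leviCivita_extend (v w : TangentSpace 𝓘(ℝ, E) x₀) :
    coordField x₀ (fun y ↦ leviCivita 𝓘(ℝ, E) M (extend E w) y (extend E v y))
      =ᶠ[𝓝 (extChartAt 𝓘(ℝ, E) x₀ x₀)]
      fun z ↦ christoffel (localMetric x₀) z (toModel x₀ x₀ v) (toModel x₀ x₀ w) := by
  filter_upwards [extChartAt_target_mem_nhds x₀,
    (coordField_extend_eventuallyEq v).eventuallyEq_nhds,
    (coordField_extend_eventuallyEq w).eventuallyEq_nhds] with z hz hv hw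
  refine (toModel_leviCivita hz (hw.differentiableAt_iff.2 (differentiableAt_const _)) _).trans ?_
  rw [hw.fderiv_eq, hw.eq_of_nhds]
  have : toModel x₀ _ (extend E v ((extChartAt 𝓘(ℝ, E) x₀).symm z)) = toModel x₀ x₀ v :=
    hv.eq_of_nhds
  rw [this]
  simp

/-- The curvature tensor at the centre of a chart, through the Christoffel symbols. The fields used
in its definition are constant in that chart, so that their bracket vanishes. -/
theorem toModel_curvature (v w u : TangentSpace 𝓘(ℝ, E) x₀) :
    let Γ := christoffel (localMetric x₀)
    let z := extChartAt 𝓘(ℝ, E) x₀ x₀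
    let A := toModel x₀ x₀
    A (curvature 𝓘(ℝ, E) v w u)
      = fderiv ℝ Γ z (A v) (A w) (A u) + Γ z (A v) (Γ z (A w) (A u))
        - (fderiv ℝ Γ z (A w) (A v) (A u) + Γ z (A w) (Γ z (A v) (A u))) := by
  intro Γ z A
  have := FiniteDimensional.complete ℝ E
  have hx := mem_extChartAt_source (I := 𝓘(ℝ, E)) x₀
  have hz := mem_extChartAt_target (I := 𝓘(ℝ, E)) x₀
  have hΓ : DifferentiableAt ℝ Γ z := differentiableAt_christoffel_localMetric hz
  have key (v w : TangentSpace 𝓘(ℝ, E) x₀) :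
      A (leviCivita 𝓘(ℝ, E) M (fun y ↦ leviCivita 𝓘(ℝ, E) M (extend E u) y (extend E w y)) x₀
        (extend E v x₀)) = fderiv ℝ Γ z (A v) (A w) (A u) + Γ z (A v) (Γ z (A w) (A u)) := by
    have e := coordField_leviCivita_extend (x₀ := x₀) w u
    have hd := (hΓ.hasFDerivAt.clm_apply (hasFDerivAt_const (A w) z)).clm_apply
      (hasFDerivAt_const (A u) z)
    have h := toModel_leviCivita_chart hx (e.differentiableAt_iff.2 hd.differentiableAt)
      (extend E v x₀)
    have e0 := (coordField_chart (fun y ↦ leviCivita 𝓘(ℝ, E) M (extend E u) y (extend E w y))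
      hx).symm.trans e.eq_of_nhds
    rw [e0, e.fderiv_eq, hd.fderiv, extend_apply_self] at h
    rw [extend_apply_self]
    refine h.trans ?_
    simp [Γ, z, A]
  have hb : A (mlieBracket 𝓘(ℝ, E) (extend E v) (extend E w) x₀) = 0 := by
    have hv := coordField_extend_eventuallyEq (x₀ := x₀) v
    have hw := coordField_extend_eventuallyEq (x₀ := x₀) w
    have h := toModel_mlieBracket hz (hv.differentiableAt_iff.2 (differentiableAt_const _))
      (hw.differentiableAt_iff.2 (differentiableAt_const _))
    rw [(extChartAt 𝓘(ℝ, E) x₀).left_inv hx, hv.fderiv_eq, hw.fderiv_eq] at h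
    exact h.trans (by simp)
  have hb' := toModel_injective hx (hb.trans (map_zero A).symm)
  rw [curvature, curvatureField, map_sub, map_sub, key, key, hb', map_zero, map_zero, sub_zero]

theorem isLinearMap_curvature (w u : TangentSpace 𝓘(ℝ, E) x₀) :
    IsLinearMap ℝ (fun v ↦ curvature 𝓘(ℝ, E) v w u) where
  map_add v v' := by
    apply toModel_injective (mem_extChartAt_source x₀)
    rw [map_add, toModel_curvature, toModel_curvature, toModel_curvature]
    simp only [map_add, add_apply]
    abel
  map_smul c v := by
    apply toModel_injective (mem_extChartAt_source x₀)
    rw [map_smul, toModel_curvature, toModel_curvature]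
    simp only [map_smul, smul_apply, smul_add, smul_sub]

theorem isLinearMap_strainAcceleration (u : Π x : M, TangentSpace 𝓘(ℝ, E) x) (p : M → ℝ) (x : M) :
    IsLinearMap ℝ (strainAcceleration 𝓘(ℝ, E) u p x) where
  map_add v v' := by
    simp only [strainAcceleration, map_add, (isLinearMap_curvature (u x) (u x)).map_add]
    abel
  map_smul c v := by
    simp only [strainAcceleration, map_smul, (isLinearMap_curvature (u x) (u x)).map_smul,
      smul_add, smul_sub, smul_neg]

end CurvatureInChart

/-! ### The flow and the material line in a chart -/

section Flow

set_option maxSynthPendingDepth 3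
set_option synthInstance.maxHeartbeats 100000

variable {E : Type*} [NormedAddCommGroup E] [NormedSpace ℝ E]
    {M : Type*} [TopologicalSpace M] [ChartedSpace E M] [IsManifold 𝓘(ℝ, E) ∞ M]
  {x₀ y : M} {z : E} {J : Set ℝ} {u : ℝ → Π x : M, TangentSpace 𝓘(ℝ, E) x}

/-- The velocity field, in the chart at `x₀`, as a function of time and position. -/
def coordVelocity (x₀ : M) (u : ℝ → Π x : M, TangentSpace 𝓘(ℝ, E) x) (q : ℝ × E) : E :=
  coordField x₀ (u q.1) q.2

theorem contDiffOn_coordVelocity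
    (hu : ContMDiffOn (𝓘(ℝ, ℝ).prod 𝓘(ℝ, E)) 𝓘(ℝ, E).tangent 2
      (fun q : ℝ × M ↦ (⟨q.2, u q.1 q.2⟩ : TangentBundle 𝓘(ℝ, E) M)) (J ×ˢ univ)) :
    ContDiffOn ℝ 2 (coordVelocity x₀ u) (J ×ˢ (extChartAt 𝓘(ℝ, E) x₀).target) := by
  have h1 : ContMDiffOn (𝓘(ℝ, ℝ).prod 𝓘(ℝ, E)) 𝓘(ℝ, E) 2
      (fun q : ℝ × M ↦ (tangentTriv x₀ ⟨q.2, u q.1 q.2⟩).2)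
      (J ×ˢ (extChartAt 𝓘(ℝ, E) x₀).source) :=
    (((tangentTriv x₀).contMDiffOn_iff (fun q hq ↦ by
      simpa [Trivialization.mem_source] using hq.2)).1 (hu.mono (by gcongr; exact subset_univ _))).2
  have h2 : ContMDiffOn 𝓘(ℝ, ℝ × E) (𝓘(ℝ, ℝ).prod 𝓘(ℝ, E)) 2
      (fun q : ℝ × E ↦ (q.1, (extChartAt 𝓘(ℝ, E) x₀).symm q.2))
      (J ×ˢ (extChartAt 𝓘(ℝ, E) x₀).target) :=
    contDiff_fst.contMDiff.contMDiffOn.prodMk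
      ((contMDiffOn_extChartAt_symm x₀).comp contDiff_snd.contMDiff.contMDiffOn fun q hq ↦ hq.2)
  have h3 := (h1.comp h2 fun q hq ↦
    ⟨hq.1, (extChartAt 𝓘(ℝ, E) x₀).map_target hq.2⟩).contDiffOn
  exact h3.congr fun q hq ↦ (tangentTriv_snd ((extChartAt 𝓘(ℝ, E) x₀).map_target hq.2) _).symm

theorem hasFDerivAt_coordField_velocity {t : ℝ}
    (h : DifferentiableAt ℝ (coordVelocity x₀ u) (t, z)) :
    HasFDerivAt (coordField x₀ (u t))
      ((fderiv ℝ (coordVelocity x₀ u) (t, z)).comp (ContinuousLinearMap.inr ℝ ℝ E)) z :=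
  h.hasFDerivAt.comp z (hasFDerivAt_prodMk_right t z)

variable {ε : ℝ} {φ : ℝ → ℝ → M}

/-- The material line in the chart at `x₀`, as a function of `(s, t)`. -/
def coordLine (x₀ : M) (φ : ℝ → ℝ → M) (q : ℝ × ℝ) : E := extChartAt 𝓘(ℝ, E) x₀ (φ q.1 q.2)

theorem contDiffAt_coordLine {q : ℝ × ℝ} (hφ : IsMaterialLine 𝓘(ℝ, E) J u ε φ) (hJ : IsOpen J)
    (hq : q ∈ Ioo (-ε) ε ×ˢ J) (hy : φ q.1 q.2 ∈ (extChartAt 𝓘(ℝ, E) x₀).source) :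
    ContDiffAt ℝ 2 (coordLine (E := E) x₀ φ) q := by
  have h1 := hφ.contMDiffOn.contMDiffAt ((isOpen_Ioo.prod hJ).mem_nhds hq)
  exact (ContMDiffAt.comp q (contMDiffAt_extChartAt' (by simpa using hy)) h1).contDiffAt

theorem eventually_mem_chart {q : ℝ × ℝ} (hφ : IsMaterialLine 𝓘(ℝ, E) J u ε φ) (hJ : IsOpen J)
    (hq : q ∈ Ioo (-ε) ε ×ˢ J) (hy : φ q.1 q.2 ∈ (extChartAt 𝓘(ℝ, E) x₀).source) :
    ∀ᶠ r in 𝓝 q, r ∈ Ioo (-ε) ε ×ˢ J ∧ φ r.1 r.2 ∈ (extChartAt 𝓘(ℝ, E) x₀).source := by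
  have h1 := (hφ.contMDiffOn.contMDiffAt ((isOpen_Ioo.prod hJ).mem_nhds hq)).continuousAt
  exact ((isOpen_Ioo.prod hJ).eventually_mem hq).and
    (h1.preimage_mem_nhds ((isOpen_extChartAt_source x₀).mem_nhds hy))

theorem fderiv_coordLine_time {q : ℝ × ℝ} (hφ : IsMaterialLine 𝓘(ℝ, E) J u ε φ) (hJ : IsOpen J)
    (hq : q ∈ Ioo (-ε) ε ×ˢ J) (hy : φ q.1 q.2 ∈ (extChartAt 𝓘(ℝ, E) x₀).source) :
    fderiv ℝ (coordLine x₀ φ) q (0, 1) = coordVelocity x₀ u (q.2, coordLine x₀ φ q) := by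
  have h1 := (mdifferentiableAt_extChartAt (I := 𝓘(ℝ, E)) (x := x₀) (y := φ q.1 q.2)
    (by simpa using hy)).hasMFDerivAt.comp q.2 (hφ.hasMFDerivAt q.1 hq.1 q.2 hq.2)
  have h2 : HasFDerivAt (fun τ ↦ coordLine (E := E) x₀ φ (q.1, τ)) (_ : ℝ →L[ℝ] E) q.2 :=
    h1.hasFDerivAt
  have h3 : HasDerivAt (fun τ ↦ coordLine (E := E) x₀ φ (q.1, τ))
      (fderiv ℝ (coordLine x₀ φ) q (0, 1)) q.2 :=
    HasFDerivAt.comp_hasDerivAt (l := coordLine (E := E) x₀ φ) (f := fun τ : ℝ ↦ (q.1, τ)) q.2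
      ((contDiffAt_coordLine hφ hJ hq hy).differentiableAt two_ne_zero).hasFDerivAt
      ((hasDerivAt_const q.2 q.1).prodMk (hasDerivAt_id q.2))
  refine (h3.unique h2.hasDerivAt).trans ?_
  rw [mfderiv_extChartAt_eq hy]
  refine Eq.trans ?_ (coordField_chart (u q.2) hy).symm
  change toModel x₀ _ ((1 : ℝ) • u q.2 (φ q.1 q.2)) = _
  rw [one_smul]

theorem toModel_materialTangent {t : ℝ} (hφ : IsMaterialLine 𝓘(ℝ, E) J u ε φ) (hJ : IsOpen J)
    (hq : ((0 : ℝ), t) ∈ Ioo (-ε) ε ×ˢ J) (hy : φ 0 t ∈ (extChartAt 𝓘(ℝ, E) x₀).source) :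
    toModel x₀ (φ 0 t) (materialTangent 𝓘(ℝ, E) φ t)
      = fderiv ℝ (coordLine (E := E) x₀ φ) (0, t) (1, 0) := by
  have h0 : MDifferentiableAt 𝓘(ℝ, ℝ) 𝓘(ℝ, E) (fun s ↦ φ s t) 0 := by
    have h1 := (hφ.contMDiffOn.contMDiffAt ((isOpen_Ioo.prod hJ).mem_nhds hq)).mdifferentiableAt
      two_ne_zero
    have h2 : MDifferentiableAt 𝓘(ℝ, ℝ) 𝓘(ℝ, ℝ × ℝ) (fun s : ℝ ↦ (s, t)) 0 :=
      (differentiableAt_id.prodMk (differentiableAt_const t)).mdifferentiableAt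
    exact MDifferentiableAt.comp (I' := 𝓘(ℝ, ℝ × ℝ)) (0 : ℝ) h1 h2
  have h1 := (mdifferentiableAt_extChartAt (I := 𝓘(ℝ, E)) (x := x₀) (y := φ 0 t)
    (by simpa using hy)).hasMFDerivAt.comp (0 : ℝ) h0.hasMFDerivAt
  have h2 : HasFDerivAt (fun s ↦ coordLine (E := E) x₀ φ (s, t)) (_ : ℝ →L[ℝ] E) 0 :=
    h1.hasFDerivAt
  have h3 : HasDerivAt (fun s ↦ coordLine (E := E) x₀ φ (s, t))
      (fderiv ℝ (coordLine x₀ φ) (0, t) (1, 0)) 0 :=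
    HasFDerivAt.comp_hasDerivAt (l := coordLine (E := E) x₀ φ) (f := fun s : ℝ ↦ (s, t)) (0 : ℝ)
      ((contDiffAt_coordLine hφ hJ hq hy).differentiableAt two_ne_zero).hasFDerivAt
      ((hasDerivAt_id (0 : ℝ)).prodMk (hasDerivAt_const (0 : ℝ) t))
  refine Eq.trans ?_ (h3.unique h2.hasDerivAt).symm
  rw [mfderiv_extChartAt_eq hy]
  rfl

variable [FiniteDimensional ℝ E] [RiemannianBundle (fun x : M ↦ TangentSpace 𝓘(ℝ, E) x)]
    [IsContMDiffRiemannianBundle 𝓘(ℝ, E) ∞ E (fun x : M ↦ TangentSpace 𝓘(ℝ, E) x)]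
    {p : ℝ → M → ℝ}

/-- The momentum equation in the chart at `x₀`. -/
theorem momentum_coord {t : ℝ} (hflow : IsEulerFlow 𝓘(ℝ, E) J u p) (hJ : IsOpen J) (ht : t ∈ J)
    (hz : z ∈ (extChartAt 𝓘(ℝ, E) x₀).target) :
    fderiv ℝ (coordVelocity x₀ u) (t, z) (1, 0)
      + (fderiv ℝ (coordVelocity x₀ u) (t, z) (0, coordVelocity x₀ u (t, z))
        + christoffel (localMetric x₀) z (coordVelocity x₀ u (t, z)) (coordVelocity x₀ u (t, z)))
      = -coordField x₀ (grad 𝓘(ℝ, E) (p t)) z := by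
  have hy := (extChartAt 𝓘(ℝ, E) x₀).map_target hz
  have hd : DifferentiableAt ℝ (coordVelocity x₀ u) (t, z) :=
    ((contDiffOn_coordVelocity hflow.contMDiffOn_velocity).contDiffAt
      ((hJ.prod (isOpen_extChartAt_target x₀)).mem_nhds ⟨ht, hz⟩)).differentiableAt two_ne_zero
  have h1 : HasDerivAt (fun τ ↦ coordVelocity x₀ u (τ, z))
      (fderiv ℝ (coordVelocity x₀ u) (t, z) (1, 0)) t :=
    HasFDerivAt.comp_hasDerivAt (f := fun τ : ℝ ↦ (τ, z)) t hd.hasFDerivAt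
      ((hasDerivAt_id t).prodMk (hasDerivAt_const t z))
  have h2 : HasDerivAt (fun τ ↦ u τ ((extChartAt 𝓘(ℝ, E) x₀).symm z))
      (ofModel x₀ _ (fderiv ℝ (coordVelocity x₀ u) (t, z) (1, 0))) t := by
    refine ((ContinuousLinearMap.hasFDerivAt
      (F := TangentSpace 𝓘(ℝ, E) ((extChartAt 𝓘(ℝ, E) x₀).symm z))
      (ofModel x₀ ((extChartAt 𝓘(ℝ, E) x₀).symm z))).comp_hasDerivAt t h1).congr_of_eventuallyEq
      (Filter.Eventually.of_forall fun τ ↦ ?_)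
    exact (ofModel_toModel hy _).symm
  have h3 := congrArg (toModel x₀ _) (hflow.momentum t ht ((extChartAt 𝓘(ℝ, E) x₀).symm z))
  have h4 := hasFDerivAt_coordField_velocity hd
  rw [h2.deriv, map_add, toModel_ofModel hy, toModel_leviCivita hz h4.differentiableAt, h4.fderiv,
    map_neg] at h3
  exact h3

end Flow

/-! ### The second derivative of the length of a material tangent -/

section StrainAcceleration

set_option maxSynthPendingDepth 3
set_option synthInstance.maxHeartbeats 100000

variable {E : Type*} [NormedAddCommGroup E] [NormedSpace ℝ E] [FiniteDimensional ℝ E]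
  {M : Type*} [TopologicalSpace M] [ChartedSpace E M] [IsManifold 𝓘(ℝ, E) ∞ M]
  [RiemannianBundle (fun x : M ↦ TangentSpace 𝓘(ℝ, E) x)]
  [IsContMDiffRiemannianBundle 𝓘(ℝ, E) ∞ E (fun x : M ↦ TangentSpace 𝓘(ℝ, E) x)]
  {x₀ : M} {J : Set ℝ} {u : ℝ → Π x : M, TangentSpace 𝓘(ℝ, E) x} {p : ℝ → M → ℝ}
  {ε : ℝ} {φ : ℝ → ℝ → M} {t : ℝ}

omit [FiniteDimensional ℝ E]
  [IsContMDiffRiemannianBundle 𝓘(ℝ, E) ∞ E (fun x : M ↦ TangentSpace 𝓘(ℝ, E) x)] in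
theorem normSq_materialTangent_eq (hJ : IsOpen J) (hε : 0 < ε)
    (hφ : IsMaterialLine 𝓘(ℝ, E) J u ε φ) (ht : t ∈ J)
    (hy : φ 0 t ∈ (extChartAt 𝓘(ℝ, E) x₀).source) :
    ‖materialTangent 𝓘(ℝ, E) φ t‖ ^ 2
      = localMetric x₀ (coordLine x₀ φ (0, t)) (fderiv ℝ (coordLine (E := E) x₀ φ) (0, t) (1, 0))
          (fderiv ℝ (coordLine (E := E) x₀ φ) (0, t) (1, 0)) := by
  rw [← toModel_materialTangent hφ hJ ⟨by simpa using hε, ht⟩ hy, coordLine,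
    localMetric_chart hy, real_inner_self_eq_norm_sq]

omit [FiniteDimensional ℝ E] [RiemannianBundle (fun x : M ↦ TangentSpace 𝓘(ℝ, E) x)]
  [IsContMDiffRiemannianBundle 𝓘(ℝ, E) ∞ E (fun x : M ↦ TangentSpace 𝓘(ℝ, E) x)] in
/-- The trajectory and the material tangent in a chart solve the equation of motion and its
linearization. -/
theorem hasDerivAt_coordLine (hJ : IsOpen J) (hε : 0 < ε)
    (hφ : IsMaterialLine 𝓘(ℝ, E) J u ε φ)
    (hu : ContMDiffOn (𝓘(ℝ, ℝ).prod 𝓘(ℝ, E)) 𝓘(ℝ, E).tangent 2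
      (fun q : ℝ × M ↦ (⟨q.2, u q.1 q.2⟩ : TangentBundle 𝓘(ℝ, E) M)) (J ×ˢ univ)) (ht : t ∈ J)
    (hy : φ 0 t ∈ (extChartAt 𝓘(ℝ, E) x₀).source) :
    HasDerivAt (fun τ ↦ coordLine x₀ φ (0, τ)) (coordVelocity x₀ u (t, coordLine x₀ φ (0, t))) t ∧
    HasDerivAt (fun τ ↦ fderiv ℝ (coordLine x₀ φ) (0, τ) (1, 0))
      (fderiv ℝ (coordVelocity x₀ u) (t, coordLine x₀ φ (0, t))
        (0, fderiv ℝ (coordLine x₀ φ) (0, t) (1, 0))) t ∧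
    ContDiffAt ℝ 2 (coordVelocity x₀ u) (t, coordLine x₀ φ (0, t)) := by
  have hq : ((0 : ℝ), t) ∈ Ioo (-ε) ε ×ˢ J := ⟨by simpa using hε, ht⟩
  have hU : ContDiffAt ℝ 2 (coordVelocity x₀ u) (t, coordLine x₀ φ (0, t)) :=
    (contDiffOn_coordVelocity hu).contDiffAt ((hJ.prod (isOpen_extChartAt_target x₀)).mem_nhds
      ⟨ht, (extChartAt 𝓘(ℝ, E) x₀).map_source hy⟩)
  have hΦ := contDiffAt_coordLine (E := E) (x₀ := x₀) hφ hJ hq hy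
  refine ⟨?_, hasDerivAt_fderiv_flow (hU.differentiableAt two_ne_zero) hΦ ?_, hU⟩
  · rw [← fderiv_coordLine_time hφ hJ hq hy]
    exact HasFDerivAt.comp_hasDerivAt (l := coordLine (E := E) x₀ φ) (f := fun τ : ℝ ↦ (0, τ)) t
      (hΦ.differentiableAt two_ne_zero).hasFDerivAt
      ((hasDerivAt_const t (0 : ℝ)).prodMk (hasDerivAt_id t))
  · filter_upwards [eventually_mem_chart hφ hJ hq hy] with r hr
    exact fderiv_coordLine_time hφ hJ hr.1 hr.2

/-- In coordinates, `d/dt |ξ|² = 2 ⟨∇_ξ u, ξ⟩`. The chart is not required to be centred at the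
point, so that the formula holds in one chart for all nearby times. -/
theorem hasDerivAt_normSq_materialTangent (hJ : IsOpen J) (hε : 0 < ε)
    (hφ : IsMaterialLine 𝓘(ℝ, E) J u ε φ)
    (hu : ContMDiffOn (𝓘(ℝ, ℝ).prod 𝓘(ℝ, E)) 𝓘(ℝ, E).tangent 2
      (fun q : ℝ × M ↦ (⟨q.2, u q.1 q.2⟩ : TangentBundle 𝓘(ℝ, E) M)) (J ×ˢ univ)) (ht : t ∈ J)
    (hy : φ 0 t ∈ (extChartAt 𝓘(ℝ, E) x₀).source) :
    HasDerivAt (fun τ ↦ ‖materialTangent 𝓘(ℝ, E) φ τ‖ ^ 2)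
      (2 * localMetric x₀ (coordLine x₀ φ (0, t))
        (fderiv ℝ (coordVelocity x₀ u) (t, coordLine x₀ φ (0, t))
            (0, fderiv ℝ (coordLine x₀ φ) (0, t) (1, 0))
          + christoffel (localMetric x₀) (coordLine x₀ φ (0, t))
            (fderiv ℝ (coordLine x₀ φ) (0, t) (1, 0))
            (coordVelocity x₀ u (t, coordLine x₀ φ (0, t))))
        (fderiv ℝ (coordLine x₀ φ) (0, t) (1, 0))) t := by
  have hz : coordLine x₀ φ (0, t) ∈ (extChartAt 𝓘(ℝ, E) x₀).target :=
    (extChartAt 𝓘(ℝ, E) x₀).map_source hy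
  have hs : ∀ᶠ w in 𝓝 (coordLine x₀ φ (0, t)), ∀ a b : E,
      localMetric x₀ w a b = localMetric x₀ w b a :=
    Filter.Eventually.of_forall fun w ↦ localMetric_comm
  obtain ⟨hx, hξ, -⟩ := hasDerivAt_coordLine hJ hε hφ hu ht hy
  have h1 := hasDerivAt_metric_curve hs (differentiableAt_localMetric hz)
    (isInvertible_localMetric hz) hx hξ hξ
  have hq : ((0 : ℝ), t) ∈ Ioo (-ε) ε ×ˢ J := ⟨by simpa using hε, ht⟩
  have hc : Filter.Tendsto (fun τ : ℝ ↦ ((0 : ℝ), τ)) (𝓝 t) (𝓝 (0, t)) :=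
    (Continuous.prodMk_right 0).tendsto t
  refine (h1.congr_of_eventuallyEq ?_).congr_deriv ?_
  · filter_upwards [hc.eventually (eventually_mem_chart hφ hJ hq hy)] with τ hτ
    exact normSq_materialTangent_eq hJ hε hφ hτ.1.2 hτ.2
  · rw [localMetric_comm (fderiv ℝ (coordLine x₀ φ) (0, t) (1, 0)),
      christoffel_comm hs (differentiableAt_localMetric hz) _ (coordVelocity x₀ u _)]
    ring

theorem toModel_leviCivita_velocity {y : M} (hy : y ∈ (extChartAt 𝓘(ℝ, E) x₀).source)
    (hU : DifferentiableAt ℝ (coordVelocity x₀ u) (t, extChartAt 𝓘(ℝ, E) x₀ y))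
    (v : TangentSpace 𝓘(ℝ, E) y) :
    toModel x₀ y (leviCivita 𝓘(ℝ, E) M (u t) y v)
      = fderiv ℝ (coordVelocity x₀ u) (t, extChartAt 𝓘(ℝ, E) x₀ y) (0, toModel x₀ y v)
        + christoffel (localMetric x₀) (extChartAt 𝓘(ℝ, E) x₀ y) (toModel x₀ y v)
            (coordVelocity x₀ u (t, extChartAt 𝓘(ℝ, E) x₀ y)) := by
  have h := hasFDerivAt_coordField_velocity hU
  have h' := toModel_leviCivita_chart hy h.differentiableAt v
  rw [← coordField_chart (u t) hy, h.fderiv] at h'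
  exact h'

/-- The derivative of `d/dt |ξ|² = 2 ⟨∇_ξ u, ξ⟩`: differentiating the first factor yields the
Hessian and curvature terms, differentiating the second yields `|∇_ξ u|²`. -/
theorem hasDerivAt_deriv_normSq_materialTangent (hJ : IsOpen J) (hε : 0 < ε)
    (hφ : IsMaterialLine 𝓘(ℝ, E) J u ε φ) (hflow : IsEulerFlow 𝓘(ℝ, E) J u p) (ht : t ∈ J) :
    HasDerivAt (deriv fun τ ↦ ‖materialTangent 𝓘(ℝ, E) φ τ‖ ^ 2)
      (2 * (-inner ℝ (hessian 𝓘(ℝ, E) (p t) (φ 0 t) (materialTangent 𝓘(ℝ, E) φ t))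
            (materialTangent 𝓘(ℝ, E) φ t)
          - inner ℝ (curvature 𝓘(ℝ, E) (materialTangent 𝓘(ℝ, E) φ t) (u t (φ 0 t)) (u t (φ 0 t)))
            (materialTangent 𝓘(ℝ, E) φ t)
          + ‖leviCivita 𝓘(ℝ, E) M (u t) (φ 0 t) (materialTangent 𝓘(ℝ, E) φ t)‖ ^ 2)) t := by
  have hu := hflow.contMDiffOn_velocity
  have hy : φ 0 t ∈ (extChartAt 𝓘(ℝ, E) (φ 0 t)).source := mem_extChartAt_source _
  have hq : ((0 : ℝ), t) ∈ Ioo (-ε) ε ×ˢ J := ⟨by simpa using hε, ht⟩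
  have hz : coordLine (E := E) (φ 0 t) φ (0, t) ∈ (extChartAt 𝓘(ℝ, E) (φ 0 t)).target :=
    (extChartAt 𝓘(ℝ, E) (φ 0 t)).map_source hy
  have hs : ∀ᶠ w in 𝓝 (coordLine (E := E) (φ 0 t) φ (0, t)), ∀ a b : E,
      localMetric (φ 0 t) w a b = localMetric (φ 0 t) w b a :=
    Filter.Eventually.of_forall fun w ↦ localMetric_comm
  have hg := differentiableAt_localMetric hz
  have hΓ := differentiableAt_christoffel_localMetric hz
  have hc : Filter.Tendsto (fun τ : ℝ ↦ ((0 : ℝ), τ)) (𝓝 t) (𝓝 (0, t)) :=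
    (Continuous.prodMk_right 0).tendsto t
  obtain ⟨hx, hξ, hU⟩ := hasDerivAt_coordLine hJ hε hφ hu ht hy
  have hP : ∀ᶠ z in 𝓝 (coordLine (E := E) (φ 0 t) φ (0, t)),
      fderiv ℝ (coordVelocity (φ 0 t) u) (t, z) (1, 0)
        + (fderiv ℝ (coordVelocity (φ 0 t) u) (t, z) (0, coordVelocity (φ 0 t) u (t, z))
          + christoffel (localMetric (φ 0 t)) z (coordVelocity (φ 0 t) u (t, z))
            (coordVelocity (φ 0 t) u (t, z)))
        = -coordField (φ 0 t) (grad 𝓘(ℝ, E) (p t)) z := by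
    filter_upwards [target_mem_nhds hz] with z hz using momentum_coord hflow hJ ht hz
  have hS := hasDerivAt_velocityGradient_euler hU hΓ
    (fun a b ↦ christoffel_comm hs hg a b) hx hξ hP
  have hN := (hasDerivAt_metric_curve hs hg (isInvertible_localMetric hz) hx hS hξ).const_mul 2
  refine (hN.congr_of_eventuallyEq ?_).congr_deriv ?_
  · filter_upwards [hc.eventually (eventually_mem_chart hφ hJ hq hy)] with τ hτ
    exact (hasDerivAt_normSq_materialTangent hJ hε hφ hu hτ.1.2 hτ.2).deriv
  · have hm := toModel_materialTangent (x₀ := φ 0 t) hφ hJ hq hy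
    have hA := toModel_leviCivita_velocity (x₀ := φ 0 t) hy (hU.differentiableAt two_ne_zero)
      (materialTangent 𝓘(ℝ, E) φ t)
    have hH := toModel_leviCivita_chart (x₀ := φ 0 t) hy (fderiv_momentum hU hΓ hP).1
      (materialTangent 𝓘(ℝ, E) φ t)
    have hR := toModel_curvature (x₀ := φ 0 t) (materialTangent 𝓘(ℝ, E) φ t)
      (u t (φ 0 t)) (u t (φ 0 t))
    have hPx := coordField_chart (x₀ := φ 0 t) (grad 𝓘(ℝ, E) (p t)) hy
    have hw : coordVelocity (φ 0 t) u (t, coordLine (φ 0 t) φ (0, t))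
        = toModel (φ 0 t) (φ 0 t) (u t (φ 0 t)) := coordField_chart (u t) hy
    have hz₀ : extChartAt 𝓘(ℝ, E) (φ 0 t) (φ 0 t) = coordLine (φ 0 t) φ (0, t) := rfl
    dsimp only at hR
    rw [← hw, hm, hz₀] at hR
    rw [← hPx, hm, hz₀] at hH
    rw [hm, hz₀] at hA
    rw [sub_add_cancel, christoffel_comm hs hg (coordVelocity (φ 0 t) u _)
        (fderiv ℝ (coordLine (φ 0 t) φ) (0, t) (1, 0)), ← hH, ← hR, ← hA, ← hm,
      ← map_neg, ← map_sub, ← hz₀, localMetric_chart hy, localMetric_chart hy, inner_sub_left,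
      inner_neg_left, real_inner_self_eq_norm_sq, hessian]

end StrainAcceleration

end RiemannianFluid

end

open RiemannianFluid in
theorem mainTheorem1
    {E : Type*} [NormedAddCommGroup E] [NormedSpace ℝ E] [FiniteDimensional ℝ E]
    {M : Type*} [TopologicalSpace M] [ChartedSpace E M] [IsManifold 𝓘(ℝ, E) ∞ M]
    [RiemannianBundle (fun x : M ↦ TangentSpace 𝓘(ℝ, E) x)]
    [IsContMDiffRiemannianBundle 𝓘(ℝ, E) ∞ E (fun x : M ↦ TangentSpace 𝓘(ℝ, E) x)]
    (J : Set ℝ) (hJ : IsOpen J)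
    (u : ℝ → Π x : M, TangentSpace 𝓘(ℝ, E) x) (p : ℝ → M → ℝ)
    (hflow : IsEulerFlow 𝓘(ℝ, E) J u p)
    (ε : ℝ) (hε : 0 < ε) (φ : ℝ → ℝ → M)
    (hφ : IsMaterialLine 𝓘(ℝ, E) J u ε φ) (t : ℝ) (ht : t ∈ J) :
    let x : ℝ → M := φ 0
    let ξ : Π t : ℝ, TangentSpace 𝓘(ℝ, E) (x t) := materialTangent 𝓘(ℝ, E) φ
    let N : ℝ → ℝ := fun t ↦ ‖ξ t‖ ^ 2
    DifferentiableAt ℝ N t ∧ DifferentiableAt ℝ (deriv N) t ∧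
      (1 / 2) * deriv (deriv N) t
        = -inner ℝ (hessian 𝓘(ℝ, E) (p t) (x t) (ξ t)) (ξ t)
          - inner ℝ (curvature 𝓘(ℝ, E) (ξ t) (u t (x t)) (u t (x t))) (ξ t)
          + ‖leviCivita 𝓘(ℝ, E) M (u t) (x t) (ξ t)‖ ^ 2 ∧
      IsLinearMap ℝ (strainAcceleration 𝓘(ℝ, E) (u t) (p t) (x t)) ∧
      (1 / 2) * deriv (deriv N) t
        = inner ℝ (strainAcceleration 𝓘(ℝ, E) (u t) (p t) (x t) (ξ t)) (ξ t) := by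
  intro x ξ N
  have h1 : HasDerivAt N _ t := hasDerivAt_normSq_materialTangent (x₀ := φ 0 t) hJ hε hφ
    hflow.contMDiffOn_velocity ht (mem_extChartAt_source _)
  have h2 : HasDerivAt (deriv N) _ t :=
    hasDerivAt_deriv_normSq_materialTangent hJ hε hφ hflow ht
  have h3 : (1 / 2) * deriv (deriv N) t
      = -inner ℝ (hessian 𝓘(ℝ, E) (p t) (x t) (ξ t)) (ξ t)
        - inner ℝ (curvature 𝓘(ℝ, E) (ξ t) (u t (x t)) (u t (x t))) (ξ t)
        + ‖leviCivita 𝓘(ℝ, E) M (u t) (x t) (ξ t)‖ ^ 2 := by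
    rw [h2.deriv, ← mul_assoc, one_div, inv_mul_cancel₀ two_ne_zero, one_mul]
  refine ⟨h1.differentiableAt, h2.differentiableAt, h3, isLinearMap_strainAcceleration _ _ _, ?_⟩
  rw [h3, strainAcceleration, inner_add_left, inner_sub_left, inner_neg_left,
    ContinuousLinearMap.adjoint_inner_left, real_inner_self_eq_norm_sq]
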